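/- Let $(M,\pi)$ be a connected Poisson manifold (smooth, finite-dimensional, Hausdorff, second countable, without boundary), with $\{f,g\}=\pi(df,dg)$ and Hamiltonian vector fields $X_f=\pi^\sharp(df)$, so that $df(X_g)=\{f,g\}$. Let $\mathfrak g$ be a finite-dimensional real abelian Lie algebra and let $\rho\colon\mathfrak g\to C^\infty(M)$, $u\mapsto H_u$, be a complete weakly Hamiltonian action: $\rho$ is linear, the cocycle $c(u,v)=\{H_u,H_v\}-H_{[u,v]}$ takes values in the Casimir functions of $(M,\pi)$ (equivalently, the vector fields $X_{H_u}$ define an infinitesimal action of $\mathfrak g$), and all vector fields $X_{H_u}$ are complete. For $x\in M$ put $(\ker c)_x=\{u\in\mathfrak g : c(u,v)(x)=0 \text{ for all } v\in\mathfrak g\}$. Suppose that $\ker c\subset\mathfrak g\times M\to M$ admits a framing $\mathfrak b'$ over the leaf space, i.e. it is a smooth sub-bundle with a smooth global trivialization by linear isomorphisms $\mathfrak b'_x\colon(\ker c)_x\to\mathbb R^k$ such that $x\mapsto(\mathfrak b'_x)^{-1}(w)\in\mathfrak g$ is constant along the symplectic leaves for each $w\in\mathbb R^k$. Fix an inner product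 on $\mathfrak g$, let $(\ker c)_x^\perp$ be the orthogonal complement of $(\ker c)_x$, and set \[N=\{x\in M : H_u(x)=0\ \text{ for all } u\in(\ker c)_x^{\perp}\}.\] Then: \begin{enumerate} \item $N$ is a non-empty Poisson--Dirac submanifold of $(M,\pi)$, of dimension $\dim M-(\dim\mathfrak g-k)$: it is an embedded submanifold, $T_xN\cap\pi^\sharp((T_xN)^\circ)=\{0\}$ for all $x\in N$, and the bivector $\pi_N$ induced on $N$ (by $\pi_N^\sharp(\alpha|_{T_xN})=\pi^\sharp(\alpha)$ for $\alpha\in T^*_xM$ with $\pi^\sharp(\alpha)\in T_xN$) is a smooth Poisson structure. \item The formula \[\rho_{\mathfrak b'}(w)(x)=H_{(\mathfrak b'_x)^{-1}(w)}(x),\qquad w\in\mathbb R^k,\ x\in N,\] defines a linear map $\rho_{\mathfrak b'}\colon\mathbb R^k\to C^\infty(N)$ that is a complete Hamiltonian action of the abelian Lie algebra $\mathbb R^k$ on $(N,\pi_N)$, i.e. a Lie algebra morphism into $(C^\infty(N),\{\cdot,\cdot\}_N)$ whose Hamiltonian vector fields are complete. It is the residual action: at each $x\in N$ the Hamiltonian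 vector field of $\rho_{\mathfrak b'}(w)$ with respect to $\pi_N$ is $X_{H_u}(x)$, where $u=(\mathfrak b'_x)^{-1}(w)$. \end{enumerate} -/

import Mathlib

open scoped Manifold ContDiff

noncomputable section

section General

variable {E : Type*} [NormedAddCommGroup E] [NormedSpace ℝ E]
  {M : Type*} [TopologicalSpace M] [ChartedSpace E M]

variable (E) in
/-- The cotangent space of the manifold `M` (modelled on `E`, without boundary) at `x`. -/
abbrev CotangentSpace (x : M) : Type _ := TangentSpace 𝓘(ℝ, E) x →L[ℝ] ℝ

/-- The bracket `{f, g}(x) = df_x (π^♯ (dg_x))` of two functions, for a field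
`π^♯ : T^*M → TM` of fibrewise linear maps. -/
def sharpBracket
    (sharp : ∀ x : M, CotangentSpace E x →ₗ[ℝ] TangentSpace 𝓘(ℝ, E) x)
    (f g : M → ℝ) (x : M) : ℝ :=
  mvfderiv 𝓘(ℝ, E) f x (sharp x (mvfderiv 𝓘(ℝ, E) g x))

variable (E M) in
/-- A Poisson structure on `M`: a smooth bivector field `π` whose bracket satisfies the Jacobi
identity. The bivector `π` is recorded through the map `π^♯ : T^*M → TM` with
`π(α, β) = α (π^♯ β)`, so that `π_x` being alternating is the skew-symmetry of `π^♯`; smoothness of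
`π` is smoothness of `π(df, dg)` for all smooth functions `f`, `g`. -/
structure PoissonStructure where
  sharp : ∀ x : M, CotangentSpace E x →ₗ[ℝ] TangentSpace 𝓘(ℝ, E) x
  skew : ∀ (x : M) (α β : CotangentSpace E x), α (sharp x β) = -β (sharp x α)
  smooth : ∀ f g : C^∞⟮𝓘(ℝ, E), M; ℝ⟯,
    ContMDiff 𝓘(ℝ, E) 𝓘(ℝ, ℝ) ∞ (sharpBracket sharp f g)
  jacobi : ∀ f g h : C^∞⟮𝓘(ℝ, E), M; ℝ⟯, ∀ x : M,
    sharpBracket sharp f (sharpBracket sharp g h) x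
      + sharpBracket sharp g (sharpBracket sharp h f) x
      + sharpBracket sharp h (sharpBracket sharp f g) x = 0

lemma smooth_mdifferentiableAt (f : C^∞⟮𝓘(ℝ, E), M; ℝ⟯) (x : M) :
    MDifferentiableAt 𝓘(ℝ, E) 𝓘(ℝ, ℝ) f x :=
  f.contMDiff.mdifferentiable (by simp) x

lemma mvfderiv_smooth_add (f g : C^∞⟮𝓘(ℝ, E), M; ℝ⟯) (x : M) :
    mvfderiv 𝓘(ℝ, E) (f + g : C^∞⟮𝓘(ℝ, E), M; ℝ⟯) x
      = mvfderiv 𝓘(ℝ, E) f x + mvfderiv 𝓘(ℝ, E) g x := by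
  rw [ContMDiffMap.coe_add]
  exact mvfderiv_add (smooth_mdifferentiableAt f x) (smooth_mdifferentiableAt g x)

lemma mvfderiv_smooth_smul (a : ℝ) (f : C^∞⟮𝓘(ℝ, E), M; ℝ⟯) (x : M) :
    mvfderiv 𝓘(ℝ, E) (a • f : C^∞⟮𝓘(ℝ, E), M; ℝ⟯) x = a • mvfderiv 𝓘(ℝ, E) f x := by
  rw [ContMDiffMap.coe_smul]
  ext v
  simp only [mvfderiv, const_smul_mfderiv (smooth_mdifferentiableAt f x) a]
  rfl

namespace PoissonStructure

variable (π : PoissonStructure E M)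

/-- The Poisson bracket of two smooth functions, as a smooth function. -/
def bracketFun (f g : C^∞⟮𝓘(ℝ, E), M; ℝ⟯) : C^∞⟮𝓘(ℝ, E), M; ℝ⟯ :=
  ⟨sharpBracket π.sharp f g, π.smooth f g⟩

lemma bracketFun_apply (f g : C^∞⟮𝓘(ℝ, E), M; ℝ⟯) (x : M) :
    π.bracketFun f g x = mvfderiv 𝓘(ℝ, E) f x (π.sharp x (mvfderiv 𝓘(ℝ, E) g x)) := rfl

/-- The Poisson bracket `{f, g} = π(df, dg)`, as a bilinear map on `C^∞(M)`. -/
def bracket : C^∞⟮𝓘(ℝ, E), M; ℝ⟯ →ₗ[ℝ] C^∞⟮𝓘(ℝ, E), M; ℝ⟯ →ₗ[ℝ] C^∞⟮𝓘(ℝ, E), M; ℝ⟯ :=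
  LinearMap.mk₂ ℝ π.bracketFun
    (fun f f' g => by
      ext x
      rw [ContMDiffMap.coe_add, Pi.add_apply]
      simp only [bracketFun_apply, mvfderiv_smooth_add, add_apply])
    (fun a f g => by
      ext x
      rw [ContMDiffMap.coe_smul, Pi.smul_apply]
      simp only [bracketFun_apply, mvfderiv_smooth_smul, smul_apply])
    (fun f g g' => by
      ext x
      rw [ContMDiffMap.coe_add, Pi.add_apply]
      simp only [bracketFun_apply, mvfderiv_smooth_add, map_add])
    (fun a f g => by
      ext x
      rw [ContMDiffMap.coe_smul, Pi.smul_apply]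
      simp only [bracketFun_apply, mvfderiv_smooth_smul, map_smul])

lemma bracket_apply (f g : C^∞⟮𝓘(ℝ, E), M; ℝ⟯) (x : M) :
    π.bracket f g x = mvfderiv 𝓘(ℝ, E) f x (π.sharp x (mvfderiv 𝓘(ℝ, E) g x)) := rfl

/-- The Hamiltonian vector field `X_f = π^♯(df)`; thus `dg(X_f) = {g, f}`. -/
def hamVF (f : C^∞⟮𝓘(ℝ, E), M; ℝ⟯) (x : M) : TangentSpace 𝓘(ℝ, E) x :=
  π.sharp x (mvfderiv 𝓘(ℝ, E) f x)

lemma bracket_skew (f g : C^∞⟮𝓘(ℝ, E), M; ℝ⟯) : π.bracket f g = -π.bracket g f := by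
  ext x
  rw [ContMDiffMap.coe_neg, Pi.neg_apply, bracket_apply, bracket_apply]
  exact π.skew x _ _

lemma bracket_jacobi (f g h : C^∞⟮𝓘(ℝ, E), M; ℝ⟯) :
    π.bracket f (π.bracket g h) + π.bracket g (π.bracket h f)
      + π.bracket h (π.bracket f g) = 0 := by
  ext x
  exact π.jacobi f g h x

/-- Casimir functions. -/
def IsCasimir (f : C^∞⟮𝓘(ℝ, E), M; ℝ⟯) : Prop := ∀ g, π.bracket f g = 0

/-- Two points lie in the same symplectic leaf if they are joined by finitely many segments of
integral curves of Hamiltonian vector fields, traversed in either direction. (Rescaling the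
Hamiltonian, every segment may be parametrised by `[0, 1]`.) -/
def SameLeaf : M → M → Prop :=
  Relation.EqvGen fun x y => ∃ (f : C^∞⟮𝓘(ℝ, E), M; ℝ⟯) (γ : ℝ → M),
    IsMIntegralCurveOn γ (π.hamVF f) (Set.Icc 0 1) ∧ γ 0 = x ∧ γ 1 = y

section Action

variable {𝔤 : Type*} [LieRing 𝔤] [LieAlgebra ℝ 𝔤]
  (ρ : 𝔤 →ₗ[ℝ] C^∞⟮𝓘(ℝ, E), M; ℝ⟯)

/-- `c(u, v) = {H_u, H_v} - H_{[u, v]}`, where `H_u = ρ(u)`. -/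
def cocycle : 𝔤 →ₗ[ℝ] 𝔤 →ₗ[ℝ] C^∞⟮𝓘(ℝ, E), M; ℝ⟯ :=
  π.bracket.compl₁₂ ρ ρ - (LieModule.toEnd ℝ 𝔤 𝔤 : 𝔤 →ₗ[ℝ] 𝔤 →ₗ[ℝ] 𝔤).compr₂ ρ

lemma cocycle_apply (u v : 𝔤) : π.cocycle ρ u v = π.bracket (ρ u) (ρ v) - ρ ⁅u, v⁆ := rfl

/-- `ρ : 𝔤 → C^∞(M)`, `u ↦ H_u`, is (a lift of) a weakly Hamiltonian action: its cocycle takes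
values in Casimir functions. This says exactly that the Hamiltonian vector fields `X_u` of the
functions `H_u` define an infinitesimal action of `𝔤`, see `isWeaklyHamiltonian_iff`. -/
def IsWeaklyHamiltonian : Prop := ∀ u v : 𝔤, π.IsCasimir (π.cocycle ρ u v)

lemma isWeaklyHamiltonian_iff :
    π.IsWeaklyHamiltonian ρ ↔ ∀ (u v : 𝔤) (f : C^∞⟮𝓘(ℝ, E), M; ℝ⟯),
      π.bracket (π.bracket f (ρ v)) (ρ u) - π.bracket (π.bracket f (ρ u)) (ρ v)
        = -π.bracket f (ρ ⁅u, v⁆) := by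
  have key : ∀ (u v : 𝔤) (f : C^∞⟮𝓘(ℝ, E), M; ℝ⟯),
      π.bracket (π.bracket f (ρ v)) (ρ u) - π.bracket (π.bracket f (ρ u)) (ρ v)
        + π.bracket f (ρ ⁅u, v⁆) = π.bracket (π.cocycle ρ u v) f := by
    intro u v f
    have h := π.bracket_jacobi f (ρ u) (ρ v)
    rw [π.bracket_skew (ρ v) f, map_neg, π.bracket_skew (ρ u) (π.bracket f (ρ v)),
      π.bracket_skew (ρ v) (π.bracket f (ρ u)), neg_neg] at h
    rw [π.bracket_skew _ f, cocycle_apply, map_sub, neg_sub, sub_eq_add_neg (π.bracket f _),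
      add_comm (π.bracket f _)]
    rw [← sub_eq_zero, ← h]
    abel
  refine forall₂_congr fun u v => forall_congr' fun f => ?_
  rw [← key, add_eq_zero_iff_eq_neg]

/-- The action given by `u ↦ H_u` is complete: every fundamental vector field `X_u` is complete. -/
def IsCompleteAction {V : Type*} [AddCommGroup V] [Module ℝ V]
    (ρ : V →ₗ[ℝ] C^∞⟮𝓘(ℝ, E), M; ℝ⟯) : Prop :=
  ∀ (u : V) (x : M), ∃ γ : ℝ → M, γ 0 = x ∧ IsMIntegralCurve γ (π.hamVF (ρ u))

/-- The value `c(x)` of the cocycle at a point, a bilinear form on `𝔤`. -/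
def cocycleAt (x : M) : LinearMap.BilinForm ℝ 𝔤 :=
  (π.cocycle ρ).compr₂
    ((LinearMap.proj x : (M → ℝ) →ₗ[ℝ] ℝ) ∘ₗ ContMDiffMap.coeFnLinearMap)

lemma cocycleAt_apply (x : M) (u v : 𝔤) : π.cocycleAt ρ x u v = π.cocycle ρ u v x := rfl

/-- The fibre at `x` of `ker c → M`: all `u ∈ 𝔤` with `c(u, v)(x) = 0` for every `v`. -/
def kerCocycle (x : M) : Submodule ℝ 𝔤 := LinearMap.ker (π.cocycleAt ρ x)

lemma mem_kerCocycle {x : M} {u : 𝔤} :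
    u ∈ π.kerCocycle ρ x ↔ ∀ v : 𝔤, π.cocycle ρ u v x = 0 := by
  simp only [kerCocycle, LinearMap.mem_ker, LinearMap.ext_iff, cocycleAt_apply,
    LinearMap.zero_apply]

/-- A framing over the leaf space, of rank `k`, of a family `F` of subspaces of the trivial bundle
`𝔤 × M`: fibrewise linear isomorphisms `F_x ≃ ℝ^k` whose inverses depend smoothly on `x` (in the
coordinates of `𝔤`) and are constant along the symplectic leaves. In particular `F` is then a
smooth sub-bundle, and its fibres are constant along the leaves. -/
structure LeafFraming (F : M → Submodule ℝ 𝔤) (k : ℕ) where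
  equiv : ∀ x : M, F x ≃ₗ[ℝ] (Fin k → ℝ)
  smooth : ∀ (w : Fin k → ℝ) (l : Module.Dual ℝ 𝔤),
    ContMDiff 𝓘(ℝ, E) 𝓘(ℝ, ℝ) ∞ fun x : M => l ((equiv x).symm w : 𝔤)
  constant : ∀ x y : M, π.SameLeaf x y →
    ∀ w : Fin k → ℝ, ((equiv x).symm w : 𝔤) = (equiv y).symm w

end Action

section Submanifold

variable {E' : Type*} [NormedAddCommGroup E'] [NormedSpace ℝ E']
  {N : Type*} [TopologicalSpace N] [ChartedSpace E' N]

variable (E E') in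
/-- The image of `T_xN` in `T_{ι x}M`. -/
def tangentImage (ι : N → M) (x : N) : Submodule ℝ (TangentSpace 𝓘(ℝ, E) (ι x)) :=
  LinearMap.range (mfderiv 𝓘(ℝ, E') 𝓘(ℝ, E) ι x).toLinearMap

/-- `ι : N → M` makes `N`, with the Poisson structure `πN`, a Poisson-Dirac submanifold of
`(M, π)`: it is an embedding; `T_xN ∩ π^♯((T_xN)°) = 0` at all `x ∈ N`, where `(T_xN)°` is the
annihilator; and `πN` is the bivector induced by `π`, that is, `πN^♯(β) = π^♯(α)` for all
`β ∈ T_x^*N` and every extension `α ∈ T_x^*M` of `β` such that `π^♯(α)` is tangent to `N`.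
(Such an extension exists by the second condition, and `π^♯(α)` does not depend on it; so `πN` is
uniquely determined, and its existence means that the induced bivector is smooth.) -/
structure IsPoissonDirac (πN : PoissonStructure E' N) (ι : N → M) : Prop where
  isSmoothEmbedding : Manifold.IsSmoothEmbedding 𝓘(ℝ, E') 𝓘(ℝ, E) ∞ ι
  inf_eq_zero : ∀ (x : N) (α : CotangentSpace E (ι x)),
    (∀ v ∈ tangentImage E E' ι x, α v = 0) →
      π.sharp (ι x) α ∈ tangentImage E E' ι x → π.sharp (ι x) α = 0
  induced : ∀ (x : N) (β : CotangentSpace E' x) (α : CotangentSpace E (ι x)),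
    (∀ v, α (mfderiv 𝓘(ℝ, E') 𝓘(ℝ, E) ι x v) = β v) →
      π.sharp (ι x) α ∈ tangentImage E E' ι x →
        mfderiv 𝓘(ℝ, E') 𝓘(ℝ, E) ι x (πN.sharp x β) = π.sharp (ι x) α

end Submanifold

end PoissonStructure

end General

end

/-!
Write `c(x)` for the skew-symmetric form `c(u, v)(x)` on `𝔤`, in coordinates with respect to a
`B`-orthonormal basis `e_i`, and `H_i = ρ(e_i)`. The complement `(ker c)_x^⊥` is the image of
`c(x)`, so `N` is the common zero set of the smooth functions `G_i = ∑_j c_ij H_j`. Since `𝔤` is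
abelian and the `c_ij = {H_i, H_j}` are Casimir functions, brackets of the constraints are matrix
products: `{G_i, H_j} = (c²)_ij` and `{G_i, G_j} = -(c³)_ij`. These matrices have constant rank
`dim 𝔤 - k`. The framing of `ker c` gives a matrix `S` of smooth functions whose columns span the
kernel of `c`, the matrix `T = c + S Sᵀ` is invertible over the ring of smooth functions, and
`c T = T c = c²`. All generalized inverses that are needed, such as `T⁻³` for `c³`, are therefore
smooth.

* `N` is an embedded submanifold: near `x ∈ N` it is cut out by the image of `G` under `c(x)`,
  which is a submersion onto the image of `c(x)` since its derivative along `X_{H_j}` is the `j`-th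
  column of `c(x)³` (`KernelFrame.exists_secondClass`). The slice charts come from the
  inverse function theorem (`exists_sliceChart`).
* `N` is non-empty: along an integral curve of `X_{H_v}` the vector `G` moves with the constant
  velocity `c² v`, and a suitable `v` makes it vanish at time one
  (`LeafFraming.exists_forall_G_eq_zero`).
* The constraints are second class, as the bracket matrix `{G_i, G_j}` is invertible on the span of
  the `X_{G_i}`. Hence `T_xN` is complementary to this span. Every function on `N`
  has local extensions to `M` that commute with the constraints along `N`; the bracket of two such
  functions commutes with the constraints again, and restricts to the induced bracket on `N`. This
  gives smoothness and the Jacobi identity at once (`SecondClass.poissonStructure`).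
* The residual Hamiltonians are the restrictions of `x ↦ H_{u(x)}(x)` with `u(x) = (b_x)⁻¹ w`. As
  `u` is constant along the leaves, its components are Casimir functions
  (`isCasimir_of_sameLeaf`), so that this function has the Hamiltonian vector field `X_{H_u}`, which
  commutes with the constraints. The flow of `X_{H_u}` preserves `N` and `u`, which gives
  completeness.
-/

noncomputable section

open scoped Matrix
open Filter Topology

/-! ### Germs of smooth functions and Hamiltonian vector fields -/

section Germs

variable {E : Type*} [NormedAddCommGroup E] [NormedSpace ℝ E]
  {M : Type*} [TopologicalSpace M] [ChartedSpace E M]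

lemma mvfderiv_congr_of_eventuallyEq {f g : M → ℝ} {x : M} (h : f =ᶠ[𝓝 x] g) :
    mvfderiv 𝓘(ℝ, E) f x = mvfderiv 𝓘(ℝ, E) g x := by
  ext v
  change mfderiv 𝓘(ℝ, E) 𝓘(ℝ, ℝ) f x v = mfderiv 𝓘(ℝ, E) 𝓘(ℝ, ℝ) g x v
  rw [h.mfderiv_eq]
  rfl

lemma mvfderiv_smooth_mul (f g : C^∞⟮𝓘(ℝ, E), M; ℝ⟯) (x : M) :
    mvfderiv 𝓘(ℝ, E) (f * g : C^∞⟮𝓘(ℝ, E), M; ℝ⟯) x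
      = f x • mvfderiv 𝓘(ℝ, E) g x + g x • mvfderiv 𝓘(ℝ, E) f x := by
  rw [ContMDiffMap.coe_mul]
  exact mvfderiv_mul (smooth_mdifferentiableAt f x) (smooth_mdifferentiableAt g x)

/-- Evaluation of smooth functions at a point. -/
def smoothEval (x : M) : C^∞⟮𝓘(ℝ, E), M; ℝ⟯ →+* ℝ :=
  (Pi.evalRingHom (fun _ : M => ℝ) x).comp ContMDiffMap.coeFnRingHom

lemma smoothEval_apply (x : M) (f : C^∞⟮𝓘(ℝ, E), M; ℝ⟯) : smoothEval x f = f x := rfl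

variable [FiniteDimensional ℝ E] [IsManifold 𝓘(ℝ, E) ∞ M] [T2Space M]

/-- The germ at `x` of a function that is smooth near `x` is the germ of a global smooth
function. -/
lemma exists_smooth_eventuallyEq {x : M} {f : M → ℝ}
    (hf : ∀ᶠ y in 𝓝 x, ContMDiffAt 𝓘(ℝ, E) 𝓘(ℝ, ℝ) ∞ f y) :
    ∃ F : C^∞⟮𝓘(ℝ, E), M; ℝ⟯, ∀ᶠ y in 𝓝 x, F y = f y := by
  obtain ⟨χ, -, hχ⟩ := (SmoothBumpFunction.nhds_basis_tsupport (I := 𝓘(ℝ, E)) x).mem_iff.1 hf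
  refine ⟨⟨fun y => χ y • f y, contMDiff_of_tsupport fun y hy => ?_⟩, ?_⟩
  · exact χ.contMDiffAt.smul (hχ (tsupport_smul_subset_left _ _ hy))
  · filter_upwards [χ.eventuallyEq_one] with y hy
    change χ y • f y = f y
    rw [hy]; simp

lemma exists_mvfderiv_eq (x : M) (α : CotangentSpace E x) :
    ∃ f : C^∞⟮𝓘(ℝ, E), M; ℝ⟯, mvfderiv 𝓘(ℝ, E) f x = α := by
  let α' : E →L[ℝ] ℝ := α
  have hs : ∀ᶠ y in 𝓝 x, ContMDiffAt 𝓘(ℝ, E) 𝓘(ℝ, ℝ) ∞ (α' ∘ extChartAt 𝓘(ℝ, E) x) y := by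
    filter_upwards [chart_source_mem_nhds E x] with y hy
    exact (α'.contDiff.contMDiff.contMDiffAt).comp y (contMDiffAt_extChartAt' hy)
  obtain ⟨F, hF⟩ := exists_smooth_eventuallyEq hs
  refine ⟨F, ?_⟩
  rw [mvfderiv_congr_of_eventuallyEq hF,
    MDifferentiableAt.mvfderiv (hs.self_of_nhds.mdifferentiableAt (by simp))]
  have : writtenInExtChartAt 𝓘(ℝ, E) 𝓘(ℝ, ℝ) x (α' ∘ extChartAt 𝓘(ℝ, E) x)
      =ᶠ[𝓝 (extChartAt 𝓘(ℝ, E) x x)] α' := by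
    filter_upwards [extChartAt_target_mem_nhds (I := 𝓘(ℝ, E)) x] with y hy
    simp only [writtenInExtChartAt, Function.comp_apply, extChartAt_model_space_eq_id,
      PartialEquiv.refl_coe, id, (extChartAt 𝓘(ℝ, E) x).right_inv hy]
  rw [modelWithCornersSelf_coe, Set.range_id, fderivWithin_univ, this.fderiv_eq]
  exact α'.fderiv

end Germs

namespace PoissonStructure

variable {E : Type*} [NormedAddCommGroup E] [NormedSpace ℝ E]
  {M : Type*} [TopologicalSpace M] [ChartedSpace E M] (π : PoissonStructure E M)

lemma bracket_apply_hamVF (f g : C^∞⟮𝓘(ℝ, E), M; ℝ⟯) (x : M) :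
    π.bracket f g x = mvfderiv 𝓘(ℝ, E) f x (π.hamVF g x) := rfl

lemma bracket_mul_left (f g h : C^∞⟮𝓘(ℝ, E), M; ℝ⟯) :
    π.bracket (f * g) h = f * π.bracket g h + g * π.bracket f h := by
  ext x
  rw [ContMDiffMap.coe_add, Pi.add_apply, ContMDiffMap.coe_mul, ContMDiffMap.coe_mul, Pi.mul_apply,
    Pi.mul_apply]
  simp only [bracket_apply_hamVF, mvfderiv_smooth_mul]
  rfl

lemma bracket_skew_apply (f g : C^∞⟮𝓘(ℝ, E), M; ℝ⟯) (x : M) :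
    π.bracket f g x = - π.bracket g f x := by
  rw [π.bracket_skew]; rfl

lemma hamVF_mul (f g : C^∞⟮𝓘(ℝ, E), M; ℝ⟯) (x : M) :
    π.hamVF (f * g) x = f x • π.hamVF g x + g x • π.hamVF f x := by
  simp only [hamVF, mvfderiv_smooth_mul, map_add, map_smul]

lemma hamVF_add (f g : C^∞⟮𝓘(ℝ, E), M; ℝ⟯) (x : M) :
    π.hamVF (f + g) x = π.hamVF f x + π.hamVF g x := by
  simp only [hamVF, mvfderiv_smooth_add, map_add]

lemma hamVF_smul (a : ℝ) (f : C^∞⟮𝓘(ℝ, E), M; ℝ⟯) (x : M) :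
    π.hamVF (a • f) x = a • π.hamVF f x := by
  simp only [hamVF, mvfderiv_smooth_smul, map_smul]

/-- At a point, `f ↦ X_f` is a linear map. -/
def hamVFₗ (x : M) : C^∞⟮𝓘(ℝ, E), M; ℝ⟯ →ₗ[ℝ] TangentSpace 𝓘(ℝ, E) x where
  toFun f := π.hamVF f x
  map_add' f g := π.hamVF_add f g x
  map_smul' a f := π.hamVF_smul a f x

lemma hamVF_sum {ι : Type*} (s : Finset ι) (f : ι → C^∞⟮𝓘(ℝ, E), M; ℝ⟯) (x : M) :
    π.hamVF (∑ i ∈ s, f i) x = ∑ i ∈ s, π.hamVF (f i) x :=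
  map_sum (π.hamVFₗ x) f s

variable [FiniteDimensional ℝ E] [IsManifold 𝓘(ℝ, E) ∞ M] [T2Space M]

lemma IsCasimir.hamVF_eq_zero {π : PoissonStructure E M} {a : C^∞⟮𝓘(ℝ, E), M; ℝ⟯}
    (ha : π.IsCasimir a) (x : M) : π.hamVF a x = 0 := by
  -- a vector on which all covectors `df` vanish is zero
  by_contra h
  let v : E := π.hamVF a x
  have hv : v ≠ 0 := h
  obtain ⟨β, hβ⟩ := SeparatingDual.exists_ne_zero (R := ℝ) hv
  obtain ⟨f, hf⟩ := exists_mvfderiv_eq x (β : CotangentSpace E x)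
  apply hβ
  have h1 : π.bracket f a x = 0 := by
    rw [π.bracket_skew_apply, ha f]; simp
  rw [bracket_apply_hamVF, hf] at h1
  exact h1

/-- Hamiltonian vector fields are smooth sections of the tangent bundle. -/
lemma contMDiff_hamVF (f : C^∞⟮𝓘(ℝ, E), M; ℝ⟯) :
    ContMDiff 𝓘(ℝ, E) 𝓘(ℝ, E).tangent ∞
      (fun x => (⟨x, π.hamVF f x⟩ : TangentBundle 𝓘(ℝ, E) M)) := by
  intro x
  refine (Bundle.contMDiffAt_section (F := E) (E := TangentSpace 𝓘(ℝ, E)) x).2 ?_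
  -- a component of `X_f` in the chart at `x` is the bracket of a coordinate function with `f`
  suffices h : ∀ l : E →L[ℝ] ℝ, ContMDiffAt 𝓘(ℝ, E) 𝓘(ℝ, ℝ) ∞ (fun y => l
      ((trivializationAt E (TangentSpace 𝓘(ℝ, E)) x ⟨y, π.hamVF f y⟩).2)) x by
    let e : E ≃L[ℝ] (Fin (Module.finrank ℝ E) → ℝ) :=
      (Module.finBasis ℝ E).equivFun.toContinuousLinearEquiv
    have h1 : ContMDiffAt 𝓘(ℝ, E) 𝓘(ℝ, Fin (Module.finrank ℝ E) → ℝ) ∞ (fun y => e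
        ((trivializationAt E (TangentSpace 𝓘(ℝ, E)) x ⟨y, π.hamVF f y⟩).2)) x :=
      contMDiffAt_pi_space.2 fun i => h ((ContinuousLinearMap.proj i).comp e.toContinuousLinearMap)
    have h2 := (e.symm.contDiff.contMDiff.contMDiffAt).comp x h1
    refine h2.congr_of_eventuallyEq (Eventually.of_forall fun y => ?_)
    simp
  intro l
  have hs : ∀ᶠ y in 𝓝 x, ContMDiffAt 𝓘(ℝ, E) 𝓘(ℝ, ℝ) ∞ (l ∘ extChartAt 𝓘(ℝ, E) x) y := by
    filter_upwards [chart_source_mem_nhds E x] with y hy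
    exact (l.contDiff.contMDiff.contMDiffAt).comp y (contMDiffAt_extChartAt' hy)
  obtain ⟨F, hF⟩ := exists_smooth_eventuallyEq hs
  refine (π.bracket F f).contMDiff.contMDiffAt.congr_of_eventuallyEq ?_
  filter_upwards [hF.eventually_nhds, chart_source_mem_nhds E x] with y hy hyx
  rw [bracket_apply_hamVF, mvfderiv_congr_of_eventuallyEq hy]
  have h1 : (trivializationAt E (TangentSpace 𝓘(ℝ, E)) x ⟨y, π.hamVF f y⟩).2
      = mfderiv 𝓘(ℝ, E) 𝓘(ℝ, E) (extChartAt 𝓘(ℝ, E) x) y (π.hamVF f y) := by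
    have h3 := congrArg (fun L : E →L[ℝ] E => L (π.hamVF f y))
      (TangentBundle.continuousLinearMapAt_trivializationAt (I := 𝓘(ℝ, E)) hyx)
    refine Eq.trans ?_ h3
    exact (congrFun (Bundle.Trivialization.coe_linearMapAt_of_mem (R := ℝ)
      (trivializationAt E (TangentSpace 𝓘(ℝ, E)) x) (by simpa using hyx)) _).symm
  rw [h1]
  have h2 : HasMFDerivAt 𝓘(ℝ, E) 𝓘(ℝ, ℝ) (l ∘ extChartAt 𝓘(ℝ, E) x) y
      (l.comp (mfderiv 𝓘(ℝ, E) 𝓘(ℝ, E) (extChartAt 𝓘(ℝ, E) x) y)) :=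
    (l.hasFDerivAt.hasMFDerivAt).comp y (mdifferentiableAt_extChartAt hyx).hasMFDerivAt
  change _ = mfderiv 𝓘(ℝ, E) 𝓘(ℝ, ℝ) _ y _
  rw [h2.mfderiv]
  rfl

end PoissonStructure

/-! ### Integral curves and Casimir functions -/

namespace PoissonStructure

variable {E : Type*} [NormedAddCommGroup E] [NormedSpace ℝ E]
  {M : Type*} [TopologicalSpace M] [ChartedSpace E M] (π : PoissonStructure E M)

/-- Along an integral curve of `X_h`, the derivative of `f` is `{f, h}`. -/
lemma hasDerivAt_comp_integralCurve {f h : C^∞⟮𝓘(ℝ, E), M; ℝ⟯} {γ : ℝ → M} {t : ℝ}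
    (hγ : HasMFDerivAt 𝓘(ℝ, ℝ) 𝓘(ℝ, E) γ t ((1 : ℝ →L[ℝ] ℝ).smulRight (π.hamVF h (γ t)))) :
    HasDerivAt (fun s => f (γ s)) (π.bracket f h (γ t)) t := by
  have h1 := (smooth_mdifferentiableAt f (γ t)).hasMFDerivAt.comp t hγ
  let D : E →L[ℝ] ℝ := mvfderiv 𝓘(ℝ, E) f (γ t)
  let v : E := π.hamVF h (γ t)
  have h2 : HasFDerivAt (fun s => f (γ s)) (D.comp ((1 : ℝ →L[ℝ] ℝ).smulRight v)) t :=
    hasMFDerivAt_iff_hasFDerivAt.1 h1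
  refine h2.hasDerivAt.congr_deriv ?_
  change D ((1 : ℝ) • v) = _
  rw [one_smul]
  rfl

/-- If `{f, h}` is a Casimir function then `f` is an affine function of the time along integral
curves of `X_h`. -/
lemma apply_integralCurve {f h : C^∞⟮𝓘(ℝ, E), M; ℝ⟯} (hc : π.IsCasimir (π.bracket f h))
    {γ : ℝ → M} (hγ : IsMIntegralCurve γ (π.hamVF h)) (t : ℝ) :
    f (γ t) = f (γ 0) + t * π.bracket f h (γ 0) := by
  have h1 : ∀ s, HasDerivAt (fun s => π.bracket f h (γ s)) 0 s := fun s => by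
    have := π.hasDerivAt_comp_integralCurve (f := π.bracket f h) (hγ s)
    rw [hc h] at this
    exact this
  have h2 : ∀ s, π.bracket f h (γ s) = π.bracket f h (γ 0) := fun s =>
    is_const_of_deriv_eq_zero (fun s => (h1 s).differentiableAt) (fun s => (h1 s).deriv) s 0
  have h3 : ∀ s, HasDerivAt (fun s => f (γ s) - s * π.bracket f h (γ 0)) 0 s := fun s => by
    have := (π.hasDerivAt_comp_integralCurve (f := f) (hγ s)).sub
      ((hasDerivAt_id s).mul_const (π.bracket f h (γ 0)))
    rw [h2 s, one_mul, sub_self] at this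
    exact this
  have h4 := is_const_of_deriv_eq_zero (fun s => (h3 s).differentiableAt)
    (fun s => (h3 s).deriv) t 0
  simp only [zero_mul, sub_zero] at h4
  linarith

lemma IsCasimir.apply_integralCurve {π : PoissonStructure E M} {a h : C^∞⟮𝓘(ℝ, E), M; ℝ⟯}
    (ha : π.IsCasimir a) {γ : ℝ → M} (hγ : IsMIntegralCurve γ (π.hamVF h)) (t : ℝ) :
    a (γ t) = a (γ 0) := by
  have h0 : π.bracket a h = 0 := ha h
  have := π.apply_integralCurve (f := a) (h := h)
    (by rw [h0]; intro g; rw [map_zero, LinearMap.zero_apply]) hγ t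
  rw [h0] at this
  simpa using this

variable [FiniteDimensional ℝ E] [IsManifold 𝓘(ℝ, E) ∞ M] [T2Space M]

/-- A smooth function that is constant along the symplectic leaves is a Casimir function: a short
piece of the integral curve of any `X_f` through a point stays in the leaf of that point. -/
lemma isCasimir_of_sameLeaf {a : C^∞⟮𝓘(ℝ, E), M; ℝ⟯}
    (ha : ∀ x y, π.SameLeaf x y → a x = a y) : π.IsCasimir a := by
  intro f
  ext x
  have : IsManifold 𝓘(ℝ, E) 1 M := IsManifold.of_le (n := ∞) (by simp)
  obtain ⟨γ, hγ0, hγ⟩ := exists_isMIntegralCurveAt_of_contMDiffAt_boundaryless (I := 𝓘(ℝ, E))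
    (v := π.hamVF f) (x₀ := x) 0 (((π.contMDiff_hamVF f).contMDiffAt).of_le (by simp))
  obtain ⟨ε, hε, hon⟩ := isMIntegralCurveAt_iff'.1 hγ
  have hder := π.hasDerivAt_comp_integralCurve (f := a) hγ.hasMFDerivAt
  rw [hγ0] at hder
  have hconst : (fun s => a (γ s)) =ᶠ[𝓝 0] fun _ => a x := by
    filter_upwards [Metric.ball_mem_nhds (0 : ℝ) hε] with t ht
    -- reparametrize `γ` on `[0, t]` as an integral curve of `X_{t f}` on `[0, 1]`
    refine (ha x (γ t) (Relation.EqvGen.rel _ _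
      ⟨t • f, γ ∘ (· * t), ?_, by simp [hγ0], by simp⟩)).symm
    have h1 := hon.comp_mul t
    have h2 : π.hamVF (t • f) = t • π.hamVF f := by
      funext y; exact π.hamVF_smul t f y
    rw [h2]
    refine h1.mono fun s hs => ?_
    simp only [Metric.mem_ball, dist_zero_right, Real.norm_eq_abs, Set.mem_ofPred_eq, abs_mul]
      at ht ⊢
    rw [abs_of_nonneg hs.1]
    calc s * |t| ≤ 1 * |t| := by gcongr; exact hs.2
      _ < ε := by linarith
  have := hder.unique ((hasDerivAt_const (0 : ℝ) (a x)).congr_of_eventuallyEq hconst)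
  simpa using this

end PoissonStructure

/-! ### Submanifolds given by slice charts -/

section Slices

variable {E : Type*} [NormedAddCommGroup E] [NormedSpace ℝ E]
  {M : Type*} [TopologicalSpace M] [ChartedSpace E M]

/-- A chart of `M`, with values in `E ≃ E' × F`, in which the subset `N` is the slice
`E' × {0}`. -/
structure SliceChart (E : Type*) [NormedAddCommGroup E] [NormedSpace ℝ E]
    {M : Type*} [TopologicalSpace M] [ChartedSpace E M] (N : Set M)
    (E' F : Type*) [NormedAddCommGroup E'] [NormedSpace ℝ E']
    [NormedAddCommGroup F] [NormedSpace ℝ F] where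
  chart : OpenPartialHomeomorph M E
  mem_maximalAtlas : chart ∈ IsManifold.maximalAtlas 𝓘(ℝ, E) ∞ M
  equiv : (E' × F) ≃L[ℝ] E
  mem_iff : ∀ y ∈ chart.source, y ∈ N ↔ (equiv.symm (chart y)).2 = 0

variable {N : Set M} {E' F : Type*} [NormedAddCommGroup E'] [NormedSpace ℝ E']
    [NormedAddCommGroup F] [NormedSpace ℝ F]

namespace SliceChart

variable (s : SliceChart E N E' F)

lemma apply_of_mem {y : M} (hy : y ∈ s.chart.source) (hN : y ∈ N) :
    s.equiv ((s.equiv.symm (s.chart y)).1, 0) = s.chart y := by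
  rw [← (s.mem_iff y hy).1 hN]
  simp

lemma symm_mem {v : E'} (hv : s.equiv (v, 0) ∈ s.chart.target) :
    s.chart.symm (s.equiv (v, 0)) ∈ N := by
  rw [s.mem_iff _ (s.chart.map_target hv), s.chart.right_inv hv]
  simp

open scoped Classical in
/-- The chart of `N` cut out by a slice chart. The point `x₀` only serves as the value of the
inverse outside of its domain. -/
def restrict (x₀ : N) : OpenPartialHomeomorph N E' where
  toFun y := (s.equiv.symm (s.chart y)).1
  invFun v := if h : s.chart.symm (s.equiv (v, 0)) ∈ N then ⟨_, h⟩ else x₀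
  source := Subtype.val ⁻¹' s.chart.source
  target := (fun v => s.equiv (v, 0)) ⁻¹' s.chart.target
  map_source' := fun y hy => by
    change s.equiv ((s.equiv.symm (s.chart y)).1, 0) ∈ s.chart.target
    rw [s.apply_of_mem hy y.2]
    exact s.chart.map_source hy
  map_target' := fun v hv => by
    rw [dif_pos (s.symm_mem hv)]
    exact s.chart.map_target hv
  left_inv' := fun y hy => by
    have h : s.chart.symm (s.equiv ((s.equiv.symm (s.chart y)).1, 0)) = y := by
      rw [s.apply_of_mem hy y.2, s.chart.left_inv hy]
    rw [dif_pos (by rw [h]; exact y.2)]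
    exact Subtype.ext h
  right_inv' := fun v hv => by
    rw [dif_pos (s.symm_mem hv)]
    change (s.equiv.symm (s.chart (s.chart.symm (s.equiv (v, 0))))).1 = v
    rw [s.chart.right_inv hv]
    simp
  open_source := s.chart.open_source.preimage continuous_subtype_val
  open_target := s.chart.open_target.preimage (by fun_prop)
  continuousOn_toFun := by
    have h : ContinuousOn (fun y : N => s.chart y) (Subtype.val ⁻¹' s.chart.source) :=
      s.chart.continuousOn.comp continuous_subtype_val.continuousOn fun _ h => h
    exact (by fun_prop : Continuous fun e : E => (s.equiv.symm e).1).comp_continuousOn h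
  continuousOn_invFun := by
    rw [Topology.IsInducing.subtypeVal.continuousOn_iff]
    have h : ContinuousOn (fun v => s.chart.symm (s.equiv (v, 0)))
        ((fun v => s.equiv (v, 0)) ⁻¹' s.chart.target) :=
      s.chart.continuousOn_symm.comp (by fun_prop : Continuous _).continuousOn fun _ h => h
    refine h.congr fun v hv => ?_
    simp only [Function.comp_apply]
    rw [dif_pos (s.symm_mem hv)]

open scoped Classical in
lemma coe_restrict_symm {x₀ : N} {v : E'} (hv : s.equiv (v, 0) ∈ s.chart.target) :
    ((s.restrict x₀).symm v : M) = s.chart.symm (s.equiv (v, 0)) := by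
  change ((dite _ _ _ : N) : M) = _
  rw [dif_pos (s.symm_mem hv)]

variable (t : N → SliceChart E N E' F) (ht : ∀ x : N, (x : M) ∈ (t x).chart.source)

/-- The charts of `N` cut out by a family of slice charts. -/
abbrev chartedSpace : ChartedSpace E' N where
  atlas := Set.range fun x : N => (t x).restrict x
  chartAt x := (t x).restrict x
  mem_chart_source x := ht x
  chart_mem_atlas x := ⟨x, rfl⟩

lemma isManifold :
    letI := chartedSpace t ht
    IsManifold 𝓘(ℝ, E') ∞ N := by
  let _ := chartedSpace t ht
  refine isManifold_of_contDiffOn _ _ _ ?_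
  rintro _ _ ⟨x, rfl⟩ ⟨y, rfl⟩
  simp only [modelWithCornersSelf_coe, modelWithCornersSelf_coe_symm, Function.id_comp,
    Function.comp_id, Set.preimage_id, Set.range_id, Set.inter_univ]
  -- the change of coordinates of `N` is a restriction of the one of `M`
  have h := (contDiffGroupoid ∞ 𝓘(ℝ, E)).compatible_of_mem_maximalAtlas
    (t x).mem_maximalAtlas (t y).mem_maximalAtlas
  rw [contDiffGroupoid, mem_groupoid_of_pregroupoid] at h
  have h1 : ContDiffOn ℝ ∞ ((t x).chart.symm.trans (t y).chart)
      ((t x).chart.symm.trans (t y).chart).source := by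
    have := h.1
    simpa only [contDiffPregroupoid, modelWithCornersSelf_coe,
      modelWithCornersSelf_coe_symm, Function.id_comp, Function.comp_id, Set.preimage_id,
      Set.range_id, Set.inter_univ] using this
  have h2 : ContDiffOn ℝ ∞ (fun v => ((t y).equiv.symm
      (((t x).chart.symm.trans (t y).chart) ((t x).equiv (v, 0)))).1)
      ((fun v => (t x).equiv (v, 0)) ⁻¹' ((t x).chart.symm.trans (t y).chart).source) := by
    refine (contDiff_fst.comp (t y).equiv.symm.contDiff).comp_contDiffOn
      (h1.comp (ContDiff.contDiffOn ?_) fun _ h => h)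
    exact (t x).equiv.contDiff.comp (contDiff_id.prodMk contDiff_const)
  have hmem : ∀ v ∈ (((t x).restrict x).symm.trans ((t y).restrict y)).source,
      (t x).equiv (v, 0) ∈ (t x).chart.target ∧
        (t x).chart.symm ((t x).equiv (v, 0)) ∈ (t y).chart.source := by
    intro v hv
    rw [OpenPartialHomeomorph.trans_source] at hv
    have h3 : (t x).equiv (v, 0) ∈ (t x).chart.target := hv.1
    have h4 : (((t x).restrict x).symm v : M) ∈ (t y).chart.source := hv.2
    rw [coe_restrict_symm _ h3] at h4
    exact ⟨h3, h4⟩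
  refine (h2.mono fun v hv => ?_).congr fun v hv => ?_
  · exact ⟨(hmem v hv).1, (hmem v hv).2⟩
  · change ((t y).equiv.symm ((t y).chart (((t x).restrict x).symm v : M))).1 = _
    rw [coe_restrict_symm _ (hmem v hv).1]
    rfl

lemma isSmoothEmbedding [IsManifold 𝓘(ℝ, E) ∞ M] :
    letI := chartedSpace t ht
    Manifold.IsSmoothEmbedding 𝓘(ℝ, E') 𝓘(ℝ, E) ∞ (Subtype.val : N → M) := by
  let _ := chartedSpace t ht
  have := isManifold t ht
  refine ⟨Manifold.IsImmersionOfComplement.isImmersion (F := F) fun x => ?_,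
    Topology.IsEmbedding.subtypeVal⟩
  refine Manifold.IsImmersionAtOfComplement.mk_of_continuousAt
    continuous_subtype_val.continuousAt (t x).equiv (chartAt E' x) (t x).chart
    (mem_chart_source E' x) (ht x) (IsManifold.chart_mem_maximalAtlas x) (t x).mem_maximalAtlas ?_
  intro v hv
  have hv' : (t x).equiv (v, 0) ∈ (t x).chart.target := by
    have : v ∈ (chartAt E' x).target := by simpa using hv
    exact this
  change (t x).chart (((t x).restrict x).symm v : M) = (t x).equiv (v, 0)
  rw [coe_restrict_symm _ hv', (t x).chart.right_inv hv']

/-- A slice chart gives a local retraction onto `N`, the projection to the slice. -/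
lemma exists_retraction [IsManifold 𝓘(ℝ, E) ∞ M] (x : N) :
    letI := chartedSpace t ht
    ∃ r : M → N, (∀ᶠ y in 𝓝 (x : M), ContMDiffAt 𝓘(ℝ, E) 𝓘(ℝ, E') ∞ r y) ∧
      ∀ᶠ y : N in 𝓝 x, r y = y := by
  let _ := chartedSpace t ht
  have := isManifold t ht
  let p : M → E' := fun y => ((t x).equiv.symm ((t x).chart y)).1
  have hp : ContMDiffOn 𝓘(ℝ, E) 𝓘(ℝ, E') ∞ p (t x).chart.source :=
    ((contDiff_fst.comp (t x).equiv.symm.contDiff).contMDiff).comp_contMDiffOn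
      (contMDiffOn_of_mem_maximalAtlas (t x).mem_maximalAtlas)
  have hsymm : ContMDiffOn 𝓘(ℝ, E') 𝓘(ℝ, E') ∞ ((t x).restrict x).symm
      ((t x).restrict x).target :=
    contMDiffOn_symm_of_mem_maximalAtlas (IsManifold.chart_mem_maximalAtlas x)
  refine ⟨fun y => ((t x).restrict x).symm (p y), ?_, ?_⟩
  · have hsrc : ∀ᶠ y in 𝓝 (x : M), y ∈ (t x).chart.source :=
      (t x).chart.open_source.mem_nhds (ht x)
    have hpx : p x ∈ ((t x).restrict x).target := ((t x).restrict x).map_source (ht x)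
    have hcont : ContinuousAt p x :=
      (hp.contMDiffAt ((t x).chart.open_source.mem_nhds (ht x))).continuousAt
    filter_upwards [hsrc.eventually_nhds, (hcont.preimage_mem_nhds
      (((t x).restrict x).open_target.mem_nhds hpx))] with y hy hpy
    exact (hsymm.contMDiffAt (((t x).restrict x).open_target.mem_nhds hpy)).comp y
      (hp.contMDiffAt hy)
  · filter_upwards [((t x).restrict x).open_source.mem_nhds (ht x)] with y hy
    exact ((t x).restrict x).left_inv hy

end SliceChart

end Slices

/-! ### Regular zero sets -/

section Atlas

variable {E : Type*} [NormedAddCommGroup E] [NormedSpace ℝ E]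
  {M : Type*} [TopologicalSpace M] [ChartedSpace E M]

lemma trans_mem_maximalAtlas {φ : OpenPartialHomeomorph M E} {ψ : OpenPartialHomeomorph E E}
    (hφ : φ ∈ IsManifold.maximalAtlas 𝓘(ℝ, E) ∞ M) (hψ : ψ ∈ contDiffGroupoid ∞ 𝓘(ℝ, E)) :
    φ.trans ψ ∈ IsManifold.maximalAtlas 𝓘(ℝ, E) ∞ M := by
  have key : φ.trans ψ ∈ (contDiffGroupoid ∞ 𝓘(ℝ, E)).maximalAtlas M := by
    intro e he
    obtain ⟨h1, h2⟩ := mem_maximalAtlas_iff.1 hφ e he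
    constructor
    · rw [OpenPartialHomeomorph.trans_symm_eq_symm_trans_symm, OpenPartialHomeomorph.trans_assoc]
      exact (contDiffGroupoid ∞ 𝓘(ℝ, E)).trans ((contDiffGroupoid ∞ 𝓘(ℝ, E)).symm hψ) h1
    · rw [← OpenPartialHomeomorph.trans_assoc]
      exact (contDiffGroupoid ∞ 𝓘(ℝ, E)).trans h2 hψ
  exact key

end Atlas

section RegularZeroSets

variable {E : Type*} [NormedAddCommGroup E] [NormedSpace ℝ E] [FiniteDimensional ℝ E]
  {E' F : Type*} [NormedAddCommGroup E'] [NormedSpace ℝ E'] [FiniteDimensional ℝ E']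
    [NormedAddCommGroup F] [NormedSpace ℝ F] [FiniteDimensional ℝ F]

lemma exists_equiv_prod_of_surjective {D : E →L[ℝ] F} (hD : Function.Surjective D)
    (hdim : Module.finrank ℝ E = Module.finrank ℝ E' + Module.finrank ℝ F) :
    ∃ L : E ≃L[ℝ] (E' × F), ∀ e, (L e).2 = D e := by
  let D' : E →ₗ[ℝ] F := D.toLinearMap
  have hker : Module.finrank ℝ (LinearMap.ker D') = Module.finrank ℝ E' := by
    have h1 := D'.finrank_range_add_finrank_ker
    rw [LinearMap.range_eq_top.2 hD, finrank_top] at h1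
    omega
  let k := LinearEquiv.ofFinrankEq _ _ hker
  obtain ⟨p, hp⟩ := (LinearMap.ker D').subtype.exists_leftInverse_of_injective
    (Submodule.ker_subtype _)
  let T : E →ₗ[ℝ] E' × F := (k.toLinearMap ∘ₗ p).prod D'
  have hT : Function.Injective T := by
    rw [← LinearMap.ker_eq_bot, LinearMap.ker_eq_bot']
    intro v hv
    have h2 : D' v = 0 := congrArg Prod.snd hv
    have h1 : k (p v) = 0 := congrArg Prod.fst hv
    have h3 : p v = ⟨v, h2⟩ := LinearMap.congr_fun hp ⟨v, h2⟩
    rw [LinearEquiv.map_eq_zero_iff, h3] at h1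
    exact congrArg Subtype.val h1
  let L := LinearEquiv.ofInjectiveOfFinrankEq T hT (by rw [hdim, Module.finrank_prod])
  exact ⟨L.toContinuousLinearEquiv, fun e => rfl⟩

/-- The inverse function theorem for smooth maps: a smooth map with invertible derivative at a
point restricts to a diffeomorphism from an open neighbourhood of the point, contained in any
prescribed neighbourhood. -/
lemma exists_contDiffGroupoid_of_hasFDerivAt {Φ : E → E} {s : Set E} {e₀ : E} (hs : s ∈ 𝓝 e₀)
    (hΦ : ∀ e ∈ s, ContDiffAt ℝ ∞ Φ e) {D : E ≃L[ℝ] E}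
    (hD : HasFDerivAt Φ (D : E →L[ℝ] E) e₀) :
    ∃ ψ ∈ contDiffGroupoid ∞ 𝓘(ℝ, E), e₀ ∈ ψ.source ∧ ψ.source ⊆ s ∧ ∀ e, ψ e = Φ e := by
  have hΦ₀ := hΦ e₀ (mem_of_mem_nhds hs)
  let ψ₀ := hΦ₀.toOpenPartialHomeomorph Φ hD (by simp)
  have hψ₀ : ∀ e, ψ₀ e = Φ e := fun e => rfl
  have hmem : e₀ ∈ ψ₀.source := hΦ₀.mem_toOpenPartialHomeomorph_source hD (by simp)
  have hcont : ContinuousAt (fderiv ℝ Φ) e₀ :=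
    (hΦ₀.fderiv_right (m := 0) (by simp)).continuousAt
  have hinv : ∀ᶠ e in 𝓝 e₀, fderiv ℝ Φ e ∈
      Set.range ((↑) : (E ≃L[ℝ] E) → (E →L[ℝ] E)) :=
    hcont.preimage_mem_nhds (by rw [hD.fderiv]; exact ContinuousLinearEquiv.nhds D)
  have hO : s ∩ {e | fderiv ℝ Φ e ∈ Set.range ((↑) : (E ≃L[ℝ] E) → (E →L[ℝ] E))} ∈ 𝓝 e₀ :=
    inter_mem hs hinv
  set O := s ∩ {e | fderiv ℝ Φ e ∈ Set.range ((↑) : (E ≃L[ℝ] E) → (E →L[ℝ] E))} with hOdef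
  have hsub : (ψ₀.restr O).source ⊆ O := fun e he => by
    rw [ψ₀.restr_source] at he
    exact interior_subset he.2
  refine ⟨ψ₀.restr O, ?_, ?_, fun e he => (hsub he).1, fun e => rfl⟩
  · rw [contDiffGroupoid, mem_groupoid_of_pregroupoid]
    constructor
    · simp only [contDiffPregroupoid, modelWithCornersSelf_coe,
        modelWithCornersSelf_coe_symm, Function.id_comp, Function.comp_id, Set.preimage_id,
        Set.range_id, Set.inter_univ]
      exact fun e he => (hΦ e (hsub he).1).contDiffWithinAt
    · simp only [contDiffPregroupoid, modelWithCornersSelf_coe,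
        modelWithCornersSelf_coe_symm, Function.id_comp, Function.comp_id, Set.preimage_id,
        Set.range_id, Set.inter_univ]
      intro e he
      have h1 := hsub ((ψ₀.restr O).map_target he)
      obtain ⟨D', hD'⟩ := h1.2
      refine ((ψ₀.restr O).contDiffAt_symm he (f₀' := D') ?_ (hΦ _ h1.1)).contDiffWithinAt
      rw [hD']
      exact ((hΦ _ h1.1).differentiableAt (by simp)).hasFDerivAt
  · rw [ψ₀.restr_source]
    exact ⟨hmem, mem_interior_iff_mem_nhds.2 hO⟩

variable {M : Type*} [TopologicalSpace M] [ChartedSpace E M] [IsManifold 𝓘(ℝ, E) ∞ M]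

/-- Near a point where `N` is the zero set of a smooth map with surjective derivative there is a
slice chart for `N`. -/
lemma exists_sliceChart {N : Set M} {g : M → F} (hg : ContMDiff 𝓘(ℝ, E) 𝓘(ℝ, F) ∞ g) {x : M}
    (hsurj : Function.Surjective (mfderiv 𝓘(ℝ, E) 𝓘(ℝ, F) g x))
    (hN : ∀ᶠ y in 𝓝 x, y ∈ N ↔ g y = 0)
    (hdim : Module.finrank ℝ E = Module.finrank ℝ E' + Module.finrank ℝ F) :
    ∃ s : SliceChart E N E' F, x ∈ s.chart.source := by
  let φ := chartAt E x
  let G : E → F := g ∘ φ.symm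
  have hG : ∀ e ∈ φ.target, ContDiffAt ℝ ∞ G e := fun e he =>
    ((hg.comp_contMDiffOn (contMDiffOn_chart_symm (x := x) (n := ∞))).contMDiffAt
      (φ.open_target.mem_nhds he)).contDiffAt
  have hD : mfderiv 𝓘(ℝ, E) 𝓘(ℝ, F) g x = fderiv ℝ G (φ x) := by
    rw [(hg.mdifferentiable (by simp) x).mfderiv, modelWithCornersSelf_coe, Set.range_id,
      fderivWithin_univ]
    rfl
  rw [hD] at hsurj
  obtain ⟨L, hL⟩ := exists_equiv_prod_of_surjective (E' := E') (D := fderiv ℝ G (φ x)) hsurj hdim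
  -- replace the `F`-component of the linear coordinates `L` by `g` itself
  let Φ : E → E := fun e => L.symm ((L e).1, G e)
  have hΦ : ∀ e ∈ φ.target, ContDiffAt ℝ ∞ Φ e := fun e he =>
    L.symm.contDiff.contDiffAt.comp e
      (((contDiff_fst.comp L.contDiff).contDiffAt).prodMk (hG e he))
  have hx : φ x ∈ φ.target := mem_chart_target E x
  have hΦ' : HasFDerivAt Φ ((ContinuousLinearEquiv.refl ℝ E : E ≃L[ℝ] E) : E →L[ℝ] E) (φ x) := by
    have h1 : HasFDerivAt (fun e => ((L e).1, G e))
        (((ContinuousLinearMap.fst ℝ E' F).comp (L : E →L[ℝ] E' × F)).prod (fderiv ℝ G (φ x)))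
        (φ x) :=
      ((ContinuousLinearMap.fst ℝ E' F).comp (L : E →L[ℝ] E' × F)).hasFDerivAt.prodMk
        ((hG _ hx).differentiableAt (by simp)).hasFDerivAt
    refine (L.symm.hasFDerivAt.comp _ h1).congr_fderiv ?_
    ext e
    change L.symm ((L e).1, fderiv ℝ G (φ x) e) = e
    rw [← hL]
    simp
  have hs : φ.target ∩ φ.symm ⁻¹' {y | y ∈ N ↔ g y = 0} ∈ 𝓝 (φ x) := by
    refine inter_mem (φ.open_target.mem_nhds hx) ?_
    refine (φ.continuousAt_symm hx).preimage_mem_nhds ?_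
    rw [φ.left_inv (mem_chart_source E x)]
    exact hN
  obtain ⟨ψ, hψ, hxψ, hψs, hψΦ⟩ := exists_contDiffGroupoid_of_hasFDerivAt hs
    (fun e he => hΦ e he.1) hΦ'
  refine ⟨⟨φ.trans ψ, trans_mem_maximalAtlas (IsManifold.chart_mem_maximalAtlas x) hψ, L.symm, ?_⟩,
    ⟨mem_chart_source E x, hxψ⟩⟩
  rintro y ⟨hy, hyψ⟩
  have h1 : φ.symm (φ y) ∈ N ↔ g (φ.symm (φ y)) = 0 := (hψs hyψ).2
  rw [φ.left_inv hy] at h1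
  have h2 : (φ.trans ψ) y = L.symm ((L (φ y)).1, G (φ y)) := hψΦ _
  rw [h1, h2]
  simp [G, φ.left_inv hy]

end RegularZeroSets

/-! ### Submanifolds cut out by second class constraints -/

namespace PoissonStructure

variable {E : Type*} [NormedAddCommGroup E] [NormedSpace ℝ E]
  {M : Type*} [TopologicalSpace M] [ChartedSpace E M]
  {E' : Type*} [NormedAddCommGroup E'] [NormedSpace ℝ E']
  {N : Type*} [TopologicalSpace N] [ChartedSpace E' N]

/-- The derivative of a local retraction is a left inverse of the derivative of `ι`. -/
lemma mfderiv_retraction_apply {ι : N → M} (hι : ContMDiff 𝓘(ℝ, E') 𝓘(ℝ, E) ∞ ι) {x : N}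
    {r : M → N} (hr : ContMDiffAt 𝓘(ℝ, E) 𝓘(ℝ, E') ∞ r (ι x)) (hrι : ∀ᶠ y in 𝓝 x, r (ι y) = y)
    (v : TangentSpace 𝓘(ℝ, E') x) :
    (mfderiv 𝓘(ℝ, E) 𝓘(ℝ, E') r (ι x) : TangentSpace 𝓘(ℝ, E) (ι x) →L[ℝ] E')
      (mfderiv 𝓘(ℝ, E') 𝓘(ℝ, E) ι x v) = v := by
  have h1 : HasMFDerivAt 𝓘(ℝ, E') 𝓘(ℝ, E') (r ∘ ι) x
      ((mfderiv 𝓘(ℝ, E) 𝓘(ℝ, E') r (ι x)).comp (mfderiv 𝓘(ℝ, E') 𝓘(ℝ, E) ι x)) :=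
    (hr.mdifferentiableAt (by simp)).hasMFDerivAt.comp x
      (hι.mdifferentiable (by simp) x).hasMFDerivAt
  have h2 : HasMFDerivAt 𝓘(ℝ, E') 𝓘(ℝ, E') (r ∘ ι) x
      (ContinuousLinearMap.id ℝ (TangentSpace 𝓘(ℝ, E') x)) :=
    (hasMFDerivAt_id x).congr_of_eventuallyEq hrι
  exact DFunLike.congr_fun (hasMFDerivAt_unique h1 h2) v

/-- A system of second class constraints `G_i = 0` for the submanifold `ι : N → M`. The matrix of
brackets `{G_i, G_j}` need not be invertible, since the constraints may be redundant, but it has a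
generalized inverse `A` on the span of the vector fields `X_{G_i}` along `N`. The last field
expresses that `ι` is an embedding through local smooth retractions of `M` onto `N`. -/
structure SecondClass (π : PoissonStructure E M) (I : Type*) [Fintype I] (E' : Type*)
    [NormedAddCommGroup E'] [NormedSpace ℝ E'] {N : Type*} [TopologicalSpace N] [ChartedSpace E' N]
    (ι : N → M) where
  G : I → C^∞⟮𝓘(ℝ, E), M; ℝ⟯
  A : I → I → C^∞⟮𝓘(ℝ, E), M; ℝ⟯
  hamVF_eq : ∀ (x : N) (k : I), π.hamVF (G k) (ι x)
    = ∑ j, ∑ l, (A j l (ι x) * π.bracket (G j) (G k) (ι x)) • π.hamVF (G l) (ι x)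
  apply_eq_zero : ∀ (x : N) (i : I), G i (ι x) = 0
  mem_tangentImage : ∀ (x : N) (v : TangentSpace 𝓘(ℝ, E) (ι x)),
    (∀ i, mvfderiv 𝓘(ℝ, E) (G i) (ι x) v = 0) → v ∈ tangentImage E E' ι x
  smooth : ContMDiff 𝓘(ℝ, E') 𝓘(ℝ, E) ∞ ι
  exists_retraction : ∀ x : N, ∃ r : M → N,
    (∀ᶠ y in 𝓝 (ι x), ContMDiffAt 𝓘(ℝ, E) 𝓘(ℝ, E') ∞ r y) ∧ ∀ᶠ y in 𝓝 x, r (ι y) = y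

namespace SecondClass

variable {π : PoissonStructure E M} {I : Type*} [Fintype I] {ι : N → M}
  (S : π.SecondClass I E' ι)

include S

lemma exists_leftInverse (x : N) :
    ∃ R : TangentSpace 𝓘(ℝ, E) (ι x) →L[ℝ] TangentSpace 𝓘(ℝ, E') x,
      ∀ v, R (mfderiv 𝓘(ℝ, E') 𝓘(ℝ, E) ι x v) = v := by
  obtain ⟨r, hr, hrι⟩ := S.exists_retraction x
  exact ⟨_, mfderiv_retraction_apply S.smooth hr.self_of_nhds hrι⟩

lemma mfderiv_injective (x : N) : Function.Injective (mfderiv 𝓘(ℝ, E') 𝓘(ℝ, E) ι x) := by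
  obtain ⟨R, hR⟩ := S.exists_leftInverse x
  exact Function.LeftInverse.injective hR

/-- The chain rule along `ι`, for a function on `M` that extends `f` near a point of `N`. -/
lemma mvfderiv_apply_mfderiv {f : N → ℝ} {F : C^∞⟮𝓘(ℝ, E), M; ℝ⟯} {x : N}
    (hF : ∀ᶠ y in 𝓝 x, F (ι y) = f y) (v : TangentSpace 𝓘(ℝ, E') x) :
    mvfderiv 𝓘(ℝ, E) F (ι x) (mfderiv 𝓘(ℝ, E') 𝓘(ℝ, E) ι x v) = mvfderiv 𝓘(ℝ, E') f x v := by
  rw [← mvfderiv_congr_of_eventuallyEq (f := F ∘ ι) hF]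
  exact (mvfderiv_comp_apply x (smooth_mdifferentiableAt F _)
    (S.smooth.mdifferentiable (by simp) x) v).symm

lemma mvfderiv_G_apply_mfderiv (i : I) (x : N) (v : TangentSpace 𝓘(ℝ, E') x) :
    mvfderiv 𝓘(ℝ, E) (S.G i) (ι x) (mfderiv 𝓘(ℝ, E') 𝓘(ℝ, E) ι x v) = 0 := by
  rw [S.mvfderiv_apply_mfderiv (f := fun _ => 0)
    (Eventually.of_forall fun y => S.apply_eq_zero y i)]
  simp [mvfderiv_const]

lemma mem_tangentImage_iff (x : N) (v : TangentSpace 𝓘(ℝ, E) (ι x)) :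
    v ∈ tangentImage E E' ι x ↔ ∀ i, mvfderiv 𝓘(ℝ, E) (S.G i) (ι x) v = 0 := by
  refine ⟨?_, S.mem_tangentImage x v⟩
  rintro ⟨w, rfl⟩ i
  exact S.mvfderiv_G_apply_mfderiv i x w

lemma sharp_mem_tangentImage_iff (x : N) (α : CotangentSpace E (ι x)) :
    π.sharp (ι x) α ∈ tangentImage E E' ι x ↔ ∀ i, α (π.hamVF (S.G i) (ι x)) = 0 := by
  rw [S.mem_tangentImage_iff]
  refine forall_congr' fun i => ?_
  rw [π.skew, neg_eq_zero]
  rfl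

/-- A covector on `N` extends to a covector on `M` that vanishes on the vectors `X_{G_i}`. -/
lemma exists_extension (x : N) (β : CotangentSpace E' x) :
    ∃ α : CotangentSpace E (ι x), (∀ v, α (mfderiv 𝓘(ℝ, E') 𝓘(ℝ, E) ι x v) = β v) ∧
      ∀ i, α (π.hamVF (S.G i) (ι x)) = 0 := by
  obtain ⟨R, hR⟩ := S.exists_leftInverse x
  let α₀ : CotangentSpace E (ι x) := β.comp R
  refine ⟨α₀ - ∑ j, ∑ l, (S.A j l (ι x) * α₀ (π.hamVF (S.G l) (ι x))) •
    mvfderiv 𝓘(ℝ, E) (S.G j) (ι x), fun v => ?_, fun k => ?_⟩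
  · simp [S.mvfderiv_G_apply_mfderiv, α₀, hR]
  · have h := congrArg α₀ (S.hamVF_eq x k)
    simp only [map_sum, map_smul, smul_eq_mul] at h
    simp only [_root_.sub_apply, _root_.sum_apply,
      _root_.smul_apply, smul_eq_mul, ← bracket_apply_hamVF]
    rw [h, sub_eq_zero]
    refine Finset.sum_congr rfl fun j _ => Finset.sum_congr rfl fun l _ => ?_
    ring

/-- The submanifold meets `π^♯` of its conormal spaces trivially. The conormal space at `x` is
spanned by the covectors `dG_i`, and a combination of the `X_{G_i}` on which all `dG_j` vanish
is zero, because the bracket matrix has a generalized inverse. -/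
lemma sharp_eq_zero (x : N) (α : CotangentSpace E (ι x))
    (hα : ∀ v ∈ tangentImage E E' ι x, α v = 0)
    (h : π.sharp (ι x) α ∈ tangentImage E E' ι x) : π.sharp (ι x) α = 0 := by
  have hspan : α.toLinearMap ∈ Submodule.span ℝ
      (Set.range fun i => (mvfderiv 𝓘(ℝ, E) (S.G i) (ι x)).toLinearMap) := by
    refine mem_span_of_iInf_ker_le_ker fun v hv => ?_
    refine hα v (S.mem_tangentImage x v fun i => ?_)
    exact (Submodule.mem_iInf _).1 hv i
  obtain ⟨a, ha⟩ := (Submodule.mem_span_range_iff_exists_fun ℝ).1 hspan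
  have hα' : α = ∑ i, a i • mvfderiv 𝓘(ℝ, E) (S.G i) (ι x) := by
    ext v
    have := LinearMap.congr_fun ha v
    simp only [LinearMap.sum_apply, LinearMap.smul_apply, ContinuousLinearMap.coe_coe] at this
    rw [← this]
    simp only [_root_.sum_apply, _root_.smul_apply]
  have hsharp : π.sharp (ι x) α = ∑ i, a i • π.hamVF (S.G i) (ι x) := by
    rw [hα']
    simp only [map_sum, map_smul]
    rfl
  have h0 : ∀ j, ∑ i, a i * π.bracket (S.G j) (S.G i) (ι x) = 0 := fun j => by
    have := (S.mem_tangentImage_iff x _).1 h j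
    rw [hsharp] at this
    simpa only [map_sum, map_smul, smul_eq_mul, ← bracket_apply_hamVF] using this
  rw [hsharp]
  calc ∑ i, a i • π.hamVF (S.G i) (ι x)
      = ∑ i, ∑ j, ∑ l, (S.A j l (ι x) * (a i * π.bracket (S.G j) (S.G i) (ι x))) •
          π.hamVF (S.G l) (ι x) := by
        refine Finset.sum_congr rfl fun i _ => ?_
        conv_lhs => rw [S.hamVF_eq x i]
        simp only [Finset.smul_sum, smul_smul]
        refine Finset.sum_congr rfl fun j _ => Finset.sum_congr rfl fun l _ => ?_
        congr 1
        ring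
    _ = ∑ j, ∑ l, (S.A j l (ι x) * ∑ i, a i * π.bracket (S.G j) (S.G i) (ι x)) •
          π.hamVF (S.G l) (ι x) := by
        rw [Finset.sum_comm]
        refine Finset.sum_congr rfl fun j _ => ?_
        rw [Finset.sum_comm]
        refine Finset.sum_congr rfl fun l _ => ?_
        rw [← Finset.sum_smul, Finset.mul_sum]
    _ = 0 := by simp [h0]

lemma exists_sharp (x : N) (β : CotangentSpace E' x) :
    ∃ v : TangentSpace 𝓘(ℝ, E') x, ∀ α : CotangentSpace E (ι x),
      (∀ w, α (mfderiv 𝓘(ℝ, E') 𝓘(ℝ, E) ι x w) = β w) →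
        (∀ i, α (π.hamVF (S.G i) (ι x)) = 0) →
          mfderiv 𝓘(ℝ, E') 𝓘(ℝ, E) ι x v = π.sharp (ι x) α := by
  obtain ⟨α₀, h₀, h₀'⟩ := S.exists_extension x β
  obtain ⟨v, hv⟩ := (S.sharp_mem_tangentImage_iff x α₀).2 h₀'
  refine ⟨v, fun α h h' => ?_⟩
  have hz : π.sharp (ι x) (α₀ - α) = 0 := by
    refine S.sharp_eq_zero x _ ?_ ((S.sharp_mem_tangentImage_iff x _).2 fun i => ?_)
    · rintro _ ⟨w, rfl⟩
      exact sub_eq_zero.2 ((h₀ w).trans (h w).symm)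
    · change α₀ _ - α _ = 0
      rw [h₀', h', sub_self]
  rw [map_sub, sub_eq_zero] at hz
  exact hv.trans hz

/-- The induced bivector on `N`. -/
def sharp (x : N) : CotangentSpace E' x →ₗ[ℝ] TangentSpace 𝓘(ℝ, E') x where
  toFun β := (S.exists_sharp x β).choose
  map_add' β β' := by
    obtain ⟨α, h, h'⟩ := S.exists_extension x β
    obtain ⟨α₁, h₁, h₁'⟩ := S.exists_extension x β'
    apply S.mfderiv_injective x
    rw [map_add, (S.exists_sharp x β).choose_spec α h h',
      (S.exists_sharp x β').choose_spec α₁ h₁ h₁',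
      (S.exists_sharp x (β + β')).choose_spec (α + α₁) (fun w => ?_) fun i => ?_, map_add]
    · change α _ + α₁ _ = β w + β' w
      rw [h, h₁]
    · change α _ + α₁ _ = 0
      rw [h', h₁', add_zero]
  map_smul' a β := by
    obtain ⟨α, h, h'⟩ := S.exists_extension x β
    apply S.mfderiv_injective x
    rw [map_smul, (S.exists_sharp x β).choose_spec α h h',
      (S.exists_sharp x (a • β)).choose_spec (a • α) (fun w => ?_) fun i => ?_, map_smul]
    · rfl
    · change a • α _ = a • β w
      rw [h]
    · change a • α _ = 0
      rw [h', smul_zero]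

lemma mfderiv_sharp {x : N} {β : CotangentSpace E' x} {α : CotangentSpace E (ι x)}
    (h : ∀ w, α (mfderiv 𝓘(ℝ, E') 𝓘(ℝ, E) ι x w) = β w)
    (h' : ∀ i, α (π.hamVF (S.G i) (ι x)) = 0) :
    mfderiv 𝓘(ℝ, E') 𝓘(ℝ, E) ι x (S.sharp x β) = π.sharp (ι x) α :=
  (S.exists_sharp x β).choose_spec α h h'

/-- Let the vector field `v` on `N` be `ι`-related to `V`, at the points of a curve `γ` in `N`. If
`ι ∘ γ` is an integral curve of `V` then `γ` is one of `v`. Differentiability of `γ` as a curve in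
`N` comes from the local retractions. -/
lemma isMIntegralCurve {γ : ℝ → N} {v : ∀ x : N, TangentSpace 𝓘(ℝ, E') x}
    {V : ∀ x : M, TangentSpace 𝓘(ℝ, E) x}
    (hv : ∀ t, mfderiv 𝓘(ℝ, E') 𝓘(ℝ, E) ι (γ t) (v (γ t)) = V (ι (γ t)))
    (hι : Topology.IsInducing ι) (hγ : IsMIntegralCurve (ι ∘ γ) V) : IsMIntegralCurve γ v := by
  intro t
  obtain ⟨r, hr, hrι⟩ := S.exists_retraction (γ t)
  have hcont : Continuous γ := hι.continuous_iff.2 hγ.continuous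
  have h1 : HasMFDerivAt 𝓘(ℝ, ℝ) 𝓘(ℝ, E') (r ∘ (ι ∘ γ)) t
      ((mfderiv 𝓘(ℝ, E) 𝓘(ℝ, E') r (ι (γ t))).comp
        ((1 : ℝ →L[ℝ] ℝ).smulRight (V (ι (γ t))))) :=
    (hr.self_of_nhds.mdifferentiableAt (by simp)).hasMFDerivAt.comp t (hγ t)
  have h2 : HasMFDerivAt 𝓘(ℝ, ℝ) 𝓘(ℝ, E') γ t
      ((mfderiv 𝓘(ℝ, E) 𝓘(ℝ, E') r (ι (γ t))).comp
        ((1 : ℝ →L[ℝ] ℝ).smulRight (V (ι (γ t))))) :=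
    h1.congr_of_eventuallyEq ((hcont.continuousAt.eventually hrι).mono fun s hs => hs.symm)
  have h3 := (S.smooth.mdifferentiable (by simp) (γ t)).hasMFDerivAt.comp t h2
  have h4 := hasMFDerivAt_unique h3 (hγ t)
  refine h2.congr_mfderiv ?_
  refine ContinuousLinearMap.ext_ring ?_
  apply S.mfderiv_injective (γ t)
  have h5 := DFunLike.congr_fun h4 (1 : ℝ)
  refine Eq.trans h5 ?_
  change (1 : ℝ) • V (ι (γ t)) = mfderiv 𝓘(ℝ, E') 𝓘(ℝ, E) ι (γ t) ((1 : ℝ) • v (γ t))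
  rw [one_smul, one_smul, hv]

/-- A function on `M` is admissible if its differential vanishes on the vectors `X_{G_i}` along
`N`. Brackets on `N` are computed by admissible extensions to `M`. -/
def IsAdmissible (F : C^∞⟮𝓘(ℝ, E), M; ℝ⟯) : Prop :=
  ∀ (x : N) (i : I), π.bracket F (S.G i) (ι x) = 0

variable {S}

lemma IsAdmissible.mfderiv_sharp {F : C^∞⟮𝓘(ℝ, E), M; ℝ⟯} (hF : S.IsAdmissible F) {f : N → ℝ}
    {x : N} (hf : ∀ᶠ y in 𝓝 x, F (ι y) = f y) :
    mfderiv 𝓘(ℝ, E') 𝓘(ℝ, E) ι x (S.sharp x (mvfderiv 𝓘(ℝ, E') f x)) = π.hamVF F (ι x) :=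
  S.mfderiv_sharp (S.mvfderiv_apply_mfderiv hf) (hF x)

lemma IsAdmissible.sharpBracket_eq {F H : C^∞⟮𝓘(ℝ, E), M; ℝ⟯} (hH : S.IsAdmissible H)
    {f h : N → ℝ} {x : N} (hf : ∀ᶠ y in 𝓝 x, F (ι y) = f y) (hh : ∀ᶠ y in 𝓝 x, H (ι y) = h y) :
    sharpBracket S.sharp f h x = π.bracket F H (ι x) := by
  rw [sharpBracket, ← S.mvfderiv_apply_mfderiv hf, hH.mfderiv_sharp hh]
  rfl

/-- The Hamiltonian vector field of an admissible function is tangent to `N`. -/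
lemma IsAdmissible.bracket_eq_zero {F Q : C^∞⟮𝓘(ℝ, E), M; ℝ⟯} (hF : S.IsAdmissible F)
    (hQ : ∀ x : N, Q (ι x) = 0) (x : N) : π.bracket Q F (ι x) = 0 := by
  obtain ⟨v, hv⟩ := (S.mem_tangentImage_iff x (π.hamVF F (ι x))).2 fun i => by
    rw [← bracket_apply_hamVF, bracket_skew_apply, hF, neg_zero]
  rw [bracket_apply_hamVF, ← hv]
  refine (S.mvfderiv_apply_mfderiv (f := fun _ => 0) (Eventually.of_forall hQ) v).trans ?_
  simp [mvfderiv_const]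

lemma IsAdmissible.bracket {F H : C^∞⟮𝓘(ℝ, E), M; ℝ⟯} (hF : S.IsAdmissible F)
    (hH : S.IsAdmissible H) : S.IsAdmissible (π.bracket F H) := by
  intro x i
  have h1 : π.bracket F (π.bracket H (S.G i)) (ι x) = 0 := by
    rw [bracket_skew_apply, hF.bracket_eq_zero (fun y => hH y i), neg_zero]
  have h2 : π.bracket H (π.bracket (S.G i) F) (ι x) = 0 := by
    rw [bracket_skew_apply, hH.bracket_eq_zero (fun y => ?_), neg_zero]
    rw [bracket_skew_apply, hF, neg_zero]
  have h3 := π.jacobi F H (S.G i) (ι x)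
  change π.bracket F (π.bracket H (S.G i)) (ι x) + π.bracket H (π.bracket (S.G i) F) (ι x)
    + π.bracket (S.G i) (π.bracket F H) (ι x) = 0 at h3
  rw [h1, h2, zero_add, zero_add] at h3
  rw [bracket_skew_apply, h3, neg_zero]

variable [FiniteDimensional ℝ E] [IsManifold 𝓘(ℝ, E) ∞ M] [T2Space M] (S)

/-- The germ of a smooth function on `N` extends to an admissible function: correct an arbitrary
extension `F₀` by a combination of the constraints. -/
lemma exists_isAdmissible {f : N → ℝ} (hf : ContMDiff 𝓘(ℝ, E') 𝓘(ℝ, ℝ) ∞ f) (x : N) :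
    ∃ F : C^∞⟮𝓘(ℝ, E), M; ℝ⟯, S.IsAdmissible F ∧ ∀ᶠ y in 𝓝 x, F (ι y) = f y := by
  obtain ⟨r, hr, hrι⟩ := S.exists_retraction x
  obtain ⟨F₀, hF₀⟩ := exists_smooth_eventuallyEq (x := ι x) (f := f ∘ r)
    (hr.mono fun y hy => hf.contMDiffAt.comp y hy)
  have hιc : Tendsto ι (𝓝 x) (𝓝 (ι x)) := S.smooth.continuous.continuousAt
  refine ⟨F₀ - ∑ j, ∑ l, (S.A j l * π.bracket F₀ (S.G l)) * S.G j, fun y k => ?_, ?_⟩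
  · have h := congrArg (mvfderiv 𝓘(ℝ, E) F₀ (ι y)) (S.hamVF_eq y k)
    simp only [map_sum, map_smul, smul_eq_mul, ← bracket_apply_hamVF] at h
    rw [← smoothEval_apply]
    simp only [map_sub, map_sum, LinearMap.sub_apply, LinearMap.sum_apply, bracket_mul_left,
      map_add, map_mul, smoothEval_apply, S.apply_eq_zero, zero_mul, add_zero]
    rw [h, sub_eq_zero]
    refine Finset.sum_congr rfl fun j _ => Finset.sum_congr rfl fun l _ => ?_
    ring
  · filter_upwards [hrι, hιc.eventually hF₀] with y hy hy'
    rw [← smoothEval_apply]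
    simp only [map_sub, map_sum, map_mul, smoothEval_apply, S.apply_eq_zero, mul_zero,
      Finset.sum_const_zero, sub_zero]
    rw [hy', Function.comp_apply, hy]

/-- The Poisson structure induced on a submanifold cut out by second class constraints. -/
def poissonStructure : PoissonStructure E' N where
  sharp := S.sharp
  skew x α β := by
    obtain ⟨A, h, h'⟩ := S.exists_extension x α
    obtain ⟨B, h₁, h₁'⟩ := S.exists_extension x β
    rw [← h, ← h₁, S.mfderiv_sharp h h', S.mfderiv_sharp h₁ h₁']
    exact π.skew _ _ _
  smooth f g x := by
    obtain ⟨F, -, hFf⟩ := S.exists_isAdmissible f.contMDiff x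
    obtain ⟨H, hH, hHg⟩ := S.exists_isAdmissible g.contMDiff x
    refine ((π.bracket F H).contMDiff.comp S.smooth).contMDiffAt.congr_of_eventuallyEq ?_
    filter_upwards [hFf.eventually_nhds, hHg.eventually_nhds] with y hy hy'
    exact hH.sharpBracket_eq hy hy'
  jacobi f g h x := by
    -- the bracket of admissible extensions is an admissible extension of the bracket, so the
    -- identity is inherited from `M`
    have key : ∀ {f g : C^∞⟮𝓘(ℝ, E'), N; ℝ⟯} {F H : C^∞⟮𝓘(ℝ, E), M; ℝ⟯}, S.IsAdmissible H →
        (∀ᶠ y in 𝓝 x, F (ι y) = f y) → (∀ᶠ y in 𝓝 x, H (ι y) = g y) →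
        ∀ᶠ y in 𝓝 x, π.bracket F H (ι y) = sharpBracket S.sharp f g y := by
      intro f g F H hH h1 h2
      filter_upwards [h1.eventually_nhds, h2.eventually_nhds] with y hy hy'
      exact (hH.sharpBracket_eq hy hy').symm
    obtain ⟨F₁, h₁, h₁'⟩ := S.exists_isAdmissible f.contMDiff x
    obtain ⟨F₂, h₂, h₂'⟩ := S.exists_isAdmissible g.contMDiff x
    obtain ⟨F₃, h₃, h₃'⟩ := S.exists_isAdmissible h.contMDiff x
    rw [(h₂.bracket h₃).sharpBracket_eq h₁' (key h₃ h₂' h₃'),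
      (h₃.bracket h₁).sharpBracket_eq h₂' (key h₁ h₃' h₁'),
      (h₁.bracket h₂).sharpBracket_eq h₃' (key h₂ h₁' h₂')]
    exact π.jacobi F₁ F₂ F₃ (ι x)

lemma isPoissonDirac (hι : Manifold.IsSmoothEmbedding 𝓘(ℝ, E') 𝓘(ℝ, E) ∞ ι) :
    π.IsPoissonDirac S.poissonStructure ι where
  isSmoothEmbedding := hι
  inf_eq_zero := S.sharp_eq_zero
  induced x _ α h h' := S.mfderiv_sharp h ((S.sharp_mem_tangentImage_iff x α).1 h')

variable {S}

lemma IsAdmissible.mfderiv_hamVF {F : C^∞⟮𝓘(ℝ, E), M; ℝ⟯}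
    (hF : S.IsAdmissible F) {f : C^∞⟮𝓘(ℝ, E'), N; ℝ⟯} (hf : ∀ y, F (ι y) = f y) (x : N) :
    mfderiv 𝓘(ℝ, E') 𝓘(ℝ, E) ι x (S.poissonStructure.hamVF f x) = π.hamVF F (ι x) :=
  hF.mfderiv_sharp (Eventually.of_forall hf)

lemma IsAdmissible.bracket_apply {F H : C^∞⟮𝓘(ℝ, E), M; ℝ⟯}
    (hH : S.IsAdmissible H) {f h : C^∞⟮𝓘(ℝ, E'), N; ℝ⟯}
    (hf : ∀ y, F (ι y) = f y) (hh : ∀ y, H (ι y) = h y) (x : N) :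
    S.poissonStructure.bracket f h x = π.bracket F H (ι x) :=
  hH.sharpBracket_eq (Eventually.of_forall hf) (Eventually.of_forall hh)

end SecondClass

end PoissonStructure

/-! ### The constraints of a family of functions with Casimir brackets -/

section MatrixLemmas

/-- If the columns of `S` form a basis of the kernel of the skew-symmetric matrix `C`, then
`C + S Sᵀ` is invertible, because the image of `C` is the orthogonal complement of its kernel. -/
lemma det_add_mul_transpose_ne_zero {I K : Type*} [Fintype I] [DecidableEq I] [Fintype K]
    {C : Matrix I I ℝ} {S : Matrix I K ℝ} (hC : Cᵀ = -C) (hCS : C * S = 0)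
    (hker : ∀ y, C *ᵥ y = 0 → ∃ z, S *ᵥ z = y) :
    (C + S * Sᵀ).det ≠ 0 := by
  intro hdet
  obtain ⟨y, hy0, hy⟩ := Matrix.exists_mulVec_eq_zero_iff.2 hdet
  apply hy0
  have hSC : Sᵀ * C = 0 := by
    have := congrArg Matrix.transpose hCS
    rw [Matrix.transpose_mul, hC, Matrix.mul_neg, Matrix.transpose_zero, neg_eq_zero] at this
    exact this
  rw [Matrix.add_mulVec, ← Matrix.mulVec_mulVec] at hy
  -- apply `Sᵀ`, which kills the image of `C`
  have h1 : (Sᵀ * S) *ᵥ (Sᵀ *ᵥ y) = 0 := by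
    have := congrArg (Sᵀ *ᵥ ·) hy
    simp only [Matrix.mulVec_add, Matrix.mulVec_mulVec, Matrix.mulVec_zero, hSC,
      Matrix.zero_mulVec, zero_add] at this
    simpa only [Matrix.mulVec_mulVec, Matrix.mul_assoc] using this
  have h2 : S *ᵥ (Sᵀ *ᵥ y) = 0 := by
    have := congrArg ((Sᵀ *ᵥ y) ⬝ᵥ ·) h1
    simp only [← Matrix.mulVec_mulVec, dotProduct_zero] at this
    rw [Matrix.dotProduct_mulVec _ Sᵀ, Matrix.vecMul_transpose] at this
    exact dotProduct_self_eq_zero.1 this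
  rw [h2, add_zero] at hy
  obtain ⟨z, rfl⟩ := hker y hy
  have h3 : Sᵀ *ᵥ (S *ᵥ z) = 0 := by
    have h4 := congrArg ((S *ᵥ z) ⬝ᵥ ·) h2
    simp only [dotProduct_zero] at h4
    rw [Matrix.dotProduct_mulVec _ S, ← Matrix.mulVec_transpose] at h4
    exact dotProduct_self_eq_zero.1 h4
  have h5 := congrArg (z ⬝ᵥ ·) h3
  simp only [dotProduct_zero] at h5
  rw [Matrix.dotProduct_mulVec _ Sᵀ, Matrix.vecMul_transpose] at h5
  exact dotProduct_self_eq_zero.1 h5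

end MatrixLemmas

namespace PoissonStructure

variable {E : Type*} [NormedAddCommGroup E] [NormedSpace ℝ E]
  {M : Type*} [TopologicalSpace M] [ChartedSpace E M] {π : PoissonStructure E M}

lemma bracket_mul_right (f g h : C^∞⟮𝓘(ℝ, E), M; ℝ⟯) :
    π.bracket h (f * g) = f * π.bracket h g + g * π.bracket h f := by
  rw [bracket_skew, bracket_mul_left, π.bracket_skew g, π.bracket_skew f]
  ring

lemma IsCasimir.bracket_mul_left {a : C^∞⟮𝓘(ℝ, E), M; ℝ⟯} (ha : π.IsCasimir a)
    (f h : C^∞⟮𝓘(ℝ, E), M; ℝ⟯) : π.bracket (a * f) h = a * π.bracket f h := by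
  rw [PoissonStructure.bracket_mul_left, ha, mul_zero, add_zero]

lemma IsCasimir.bracket_mul_right {a : C^∞⟮𝓘(ℝ, E), M; ℝ⟯} (ha : π.IsCasimir a)
    (f h : C^∞⟮𝓘(ℝ, E), M; ℝ⟯) : π.bracket h (a * f) = a * π.bracket h f := by
  rw [PoissonStructure.bracket_mul_right, π.bracket_skew h a, ha, neg_zero, mul_zero, add_zero]

lemma IsCasimir.mul {a b : C^∞⟮𝓘(ℝ, E), M; ℝ⟯} (ha : π.IsCasimir a) (hb : π.IsCasimir b) :
    π.IsCasimir (a * b) := fun f => by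
  rw [ha.bracket_mul_left, hb, mul_zero]

lemma isCasimir_sum {I : Type*} {s : Finset I} {a : I → C^∞⟮𝓘(ℝ, E), M; ℝ⟯}
    (ha : ∀ i ∈ s, π.IsCasimir (a i)) : π.IsCasimir (∑ i ∈ s, a i) := fun f => by
  rw [map_sum, LinearMap.sum_apply]
  exact Finset.sum_eq_zero fun i hi => ha i hi f

lemma _root_.isUnit_smooth_of_forall_ne_zero {f : C^∞⟮𝓘(ℝ, E), M; ℝ⟯} (hf : ∀ x, f x ≠ 0) :
    IsUnit f := by
  refine IsUnit.of_mul_eq_one ⟨fun x => (f x)⁻¹, f.contMDiff.inv₀ hf⟩ ?_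
  ext x
  exact mul_inv_cancel₀ (hf x)

/-- A family of functions `H_i` whose brackets are Casimir functions, together with a smooth frame
`S` of the kernels of the matrices `{H_i, H_j}(x)`. -/
structure KernelFrame (π : PoissonStructure E M) (I K : Type*) [Fintype I] [Fintype K] where
  H : I → C^∞⟮𝓘(ℝ, E), M; ℝ⟯
  S : Matrix I K C^∞⟮𝓘(ℝ, E), M; ℝ⟯
  isCasimir : ∀ i j, π.IsCasimir (π.bracket (H i) (H j))
  sum_mul_eq_zero : ∀ i l, ∑ j, π.bracket (H i) (H j) * S j l = 0
  exists_eq : ∀ (x : M) (y : I → ℝ), (∀ i, ∑ j, π.bracket (H i) (H j) x * y j = 0) →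
    ∃ z : K → ℝ, ∀ i, ∑ l, S i l x * z l = y i
  injective : ∀ (x : M) (z : K → ℝ), (∀ i, ∑ l, S i l x * z l = 0) → z = 0

namespace KernelFrame

variable {I K : Type*} [Fintype I] [Fintype K] (D : π.KernelFrame I K)

/-- The matrix of brackets `{H_i, H_j}`. -/
def c : Matrix I I C^∞⟮𝓘(ℝ, E), M; ℝ⟯ := Matrix.of fun i j => π.bracket (D.H i) (D.H j)

lemma c_apply (i j : I) : D.c i j = π.bracket (D.H i) (D.H j) := rfl

lemma c_transpose : D.cᵀ = -D.c := by
  ext1 i j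
  exact π.bracket_skew _ _

lemma c_skew (i j : I) : D.c i j = - D.c j i := π.bracket_skew _ _

lemma c_mul_S : D.c * D.S = 0 := by
  ext1 i l
  exact D.sum_mul_eq_zero i l

lemma S_transpose_mul_c : D.Sᵀ * D.c = 0 := by
  have := congrArg Matrix.transpose D.c_mul_S
  rw [Matrix.transpose_mul, c_transpose, Matrix.mul_neg, Matrix.transpose_zero, neg_eq_zero] at this
  exact this

/-- The matrix of brackets at a point. -/
def cAt (x : M) : Matrix I I ℝ := D.c.map (smoothEval x)

/-- The kernel frame at a point. -/
def SAt (x : M) : Matrix I K ℝ := D.S.map (smoothEval x)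

lemma cAt_transpose (x : M) : (D.cAt x)ᵀ = -D.cAt x := by
  ext i j
  exact π.bracket_skew_apply _ _ _

lemma cAt_mul_SAt (x : M) : D.cAt x * D.SAt x = 0 := by
  rw [cAt, SAt, ← Matrix.map_mul, c_mul_S]
  ext i l
  exact map_zero (smoothEval (E := E) x)

lemma exists_SAt_mulVec_eq {x : M} {y : I → ℝ} (hy : D.cAt x *ᵥ y = 0) :
    ∃ z, D.SAt x *ᵥ z = y := by
  obtain ⟨z, hz⟩ := D.exists_eq x y fun i => congrFun hy i
  exact ⟨z, funext hz⟩

variable [DecidableEq I]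

/-- The matrix `c + S Sᵀ`, which is `c` on the image of `c` and invertible on its kernel. -/
def T : Matrix I I C^∞⟮𝓘(ℝ, E), M; ℝ⟯ := D.c + D.S * D.Sᵀ

lemma isUnit_det_T : IsUnit D.T.det := by
  refine isUnit_smooth_of_forall_ne_zero fun x => ?_
  rw [← smoothEval_apply, RingHom.map_det]
  have : (smoothEval x).mapMatrix D.T = D.cAt x + D.SAt x * (D.SAt x)ᵀ := by
    rw [T, map_add, SAt, ← Matrix.transpose_map, ← Matrix.map_mul]
    rfl
  rw [this]
  exact det_add_mul_transpose_ne_zero (D.cAt_transpose x) (D.cAt_mul_SAt x)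
    fun y hy => D.exists_SAt_mulVec_eq hy

lemma c_mul_T : D.c * D.T = D.c * D.c := by
  rw [T, mul_add, ← Matrix.mul_assoc, c_mul_S, Matrix.zero_mul, add_zero]

lemma T_mul_c : D.T * D.c = D.c * D.c := by
  rw [T, add_mul, Matrix.mul_assoc, S_transpose_mul_c, Matrix.mul_zero, add_zero]

lemma c_mul_c_mul_inv : D.c * D.c * D.T⁻¹ = D.c := by
  rw [← c_mul_T, Matrix.mul_assoc, Matrix.mul_nonsing_inv _ D.isUnit_det_T, mul_one]

lemma mul_c_mul_c_mul_inv (X : Matrix I I C^∞⟮𝓘(ℝ, E), M; ℝ⟯) :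
    X * D.c * D.c * D.T⁻¹ = X * D.c := by
  rw [Matrix.mul_assoc, Matrix.mul_assoc, ← Matrix.mul_assoc D.c D.c, c_mul_c_mul_inv]

lemma inv_mul_c : D.T⁻¹ * D.c = D.c * D.T⁻¹ := by
  have h : D.T * (D.c * D.T⁻¹) = D.c := by
    rw [← Matrix.mul_assoc, T_mul_c, c_mul_c_mul_inv]
  conv_lhs => rw [← h, ← Matrix.mul_assoc, Matrix.nonsing_inv_mul _ D.isUnit_det_T, one_mul]

/-- The constraints `G = c H`. They vanish at `x` iff the vector `(H_i(x))` is in the kernel of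
`c(x)`. -/
def G (i : I) : C^∞⟮𝓘(ℝ, E), M; ℝ⟯ := ∑ j, D.c i j * D.H j

omit [DecidableEq I] in
lemma G_apply (i : I) (x : M) : D.G i x = (D.cAt x *ᵥ fun j => D.H j x) i := by
  rw [← smoothEval_apply, G, map_sum]
  simp only [map_mul]
  rfl

omit [DecidableEq I] in
lemma bracket_G_left (i : I) (f : C^∞⟮𝓘(ℝ, E), M; ℝ⟯) :
    π.bracket (D.G i) f = ∑ j, D.c i j * π.bracket (D.H j) f := by
  rw [G, map_sum, LinearMap.sum_apply]
  exact Finset.sum_congr rfl fun j _ => (D.isCasimir i j).bracket_mul_left _ _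

omit [DecidableEq I] in
lemma bracket_G_right (i : I) (f : C^∞⟮𝓘(ℝ, E), M; ℝ⟯) :
    π.bracket f (D.G i) = ∑ j, D.c i j * π.bracket f (D.H j) := by
  rw [G, map_sum]
  exact Finset.sum_congr rfl fun j _ => (D.isCasimir i j).bracket_mul_right _ _

omit [DecidableEq I] in
lemma bracket_G_H (i j : I) : π.bracket (D.G i) (D.H j) = (D.c * D.c) i j :=
  D.bracket_G_left i _

omit [DecidableEq I] in
lemma bracket_G_G (i j : I) : π.bracket (D.G i) (D.G j) = (D.c * (D.c * D.c)) j i := by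
  rw [bracket_G_right, Matrix.mul_apply]
  refine Finset.sum_congr rfl fun l _ => ?_
  rw [bracket_G_H, Matrix.mul_apply, Matrix.mul_apply]
  congr 1
  refine Finset.sum_congr rfl fun m _ => ?_
  rw [D.c_skew i m, D.c_skew m l, neg_mul_neg, mul_comm]

omit [DecidableEq I] in
/-- The constraints are annihilated by the kernel frame; in particular they are redundant. -/
lemma SAt_transpose_mulVec_G (x : M) : (D.SAt x)ᵀ *ᵥ (fun i => D.G i x) = 0 := by
  have h : (fun i => D.G i x) = D.cAt x *ᵥ fun j => D.H j x := funext fun i => D.G_apply i x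
  have h2 : (D.SAt x)ᵀ * D.cAt x = 0 := by
    have := congrArg Matrix.transpose (D.cAt_mul_SAt x)
    rw [Matrix.transpose_mul, cAt_transpose, Matrix.mul_neg, Matrix.transpose_zero,
      neg_eq_zero] at this
    exact this
  rw [h, Matrix.mulVec_mulVec, h2, Matrix.zero_mulVec]

/-- The generalized inverse of the matrix of brackets of the constraints. -/
def A : Matrix I I C^∞⟮𝓘(ℝ, E), M; ℝ⟯ := D.T⁻¹ * D.T⁻¹ * D.T⁻¹

lemma c_mul_c_mul_c_mul_A_mul_c : D.c * (D.c * D.c) * D.A * D.c = D.c := by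
  have h1 : D.A * D.c = D.c * D.A := by
    simp only [A, Matrix.mul_assoc, inv_mul_c]
    simp only [← Matrix.mul_assoc, inv_mul_c]
  rw [Matrix.mul_assoc, h1]
  simp only [A, ← Matrix.mul_assoc, mul_c_mul_c_mul_inv]
  exact D.c_mul_c_mul_inv

variable [FiniteDimensional ℝ E] [IsManifold 𝓘(ℝ, E) ∞ M] [T2Space M]

omit [DecidableEq I] in
lemma hamVF_G (i : I) (x : M) : π.hamVF (D.G i) x = ∑ j, D.c i j x • π.hamVF (D.H j) x := by
  rw [G, hamVF_sum]
  refine Finset.sum_congr rfl fun j _ => ?_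
  rw [hamVF_mul, c_apply, (D.isCasimir i j).hamVF_eq_zero, smul_zero, add_zero]

/-- The matrix `A` inverts the brackets of the constraints on the span of the `X_{G_l}`, as
`c³ A c = c`. -/
lemma hamVF_G_eq (k : I) (x : M) : π.hamVF (D.G k) x
    = ∑ j, ∑ l, (D.A j l x * π.bracket (D.G j) (D.G k) x) • π.hamVF (D.G l) x := by
  have h : ∀ m, ∑ j, ∑ l, D.A j l x * π.bracket (D.G j) (D.G k) x * D.c l m x = D.c k m x := by
    intro m
    conv_rhs => rw [← D.c_mul_c_mul_c_mul_A_mul_c, Matrix.mul_apply, ← smoothEval_apply, map_sum]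
    rw [Finset.sum_comm]
    refine Finset.sum_congr rfl fun l _ => ?_
    rw [map_mul, Matrix.mul_apply, map_sum, Finset.sum_mul]
    refine Finset.sum_congr rfl fun j _ => ?_
    rw [map_mul, ← bracket_G_G, smoothEval_apply, smoothEval_apply, smoothEval_apply]
    ring
  rw [D.hamVF_G k]
  calc ∑ m, D.c k m x • π.hamVF (D.H m) x
      = ∑ m, (∑ j, ∑ l, D.A j l x * π.bracket (D.G j) (D.G k) x * D.c l m x) •
          π.hamVF (D.H m) x := by simp only [h]
    _ = _ := by
        simp only [hamVF_G, Finset.smul_sum, smul_smul, Finset.sum_smul]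
        rw [Finset.sum_comm]
        refine Finset.sum_congr rfl fun j _ => ?_
        rw [Finset.sum_comm]

end KernelFrame

end PoissonStructure

/-! ### The zero set of the constraints -/

lemma ker_le_range_of_finrank_eq {V E' F : Type*} [AddCommGroup V] [Module ℝ V]
    [FiniteDimensional ℝ V] [AddCommGroup E'] [Module ℝ E'] [FiniteDimensional ℝ E']
    [AddCommGroup F] [Module ℝ F] {J : E' →ₗ[ℝ] V} {D : V →ₗ[ℝ] F} (hJ : Function.Injective J)
    (hD : Function.Surjective D) (hDJ : ∀ v, D (J v) = 0)
    (hdim : Module.finrank ℝ V = Module.finrank ℝ E' + Module.finrank ℝ F) :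
    LinearMap.ker D ≤ LinearMap.range J := by
  have hle : LinearMap.range J ≤ LinearMap.ker D := by
    rintro _ ⟨v, rfl⟩
    exact hDJ v
  have h1 := D.finrank_range_add_finrank_ker
  rw [LinearMap.range_eq_top.2 hD, finrank_top] at h1
  have h2 := LinearMap.finrank_range_of_inj hJ
  exact (Submodule.eq_of_le_of_finrank_eq hle (by omega)).ge

namespace PoissonStructure

namespace KernelFrame

variable {E : Type*} [NormedAddCommGroup E] [NormedSpace ℝ E]
  {M : Type*} [TopologicalSpace M] [ChartedSpace E M] {π : PoissonStructure E M}
  {I K : Type*} [Fintype I] [Fintype K] (D : π.KernelFrame I K)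

/-- The constraints, as a map to a vector space. -/
def Gvec (x : M) (i : I) : ℝ := D.G i x

lemma contMDiff_Gvec : ContMDiff 𝓘(ℝ, E) 𝓘(ℝ, I → ℝ) ∞ D.Gvec :=
  contMDiff_pi_space.2 fun i => (D.G i).contMDiff

lemma mfderiv_Gvec_apply (x : M) (v : TangentSpace 𝓘(ℝ, E) x) (i : I) :
    (mfderiv 𝓘(ℝ, E) 𝓘(ℝ, I → ℝ) D.Gvec x v : I → ℝ) i = mvfderiv 𝓘(ℝ, E) (D.G i) x v := by
  have h1 : HasMFDerivAt 𝓘(ℝ, I → ℝ) 𝓘(ℝ, ℝ) (fun y : I → ℝ => y i) (D.Gvec x)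
      (ContinuousLinearMap.proj (R := ℝ) (φ := fun _ : I => ℝ) i) :=
    (ContinuousLinearMap.proj (R := ℝ) (φ := fun _ : I => ℝ) i).hasFDerivAt.hasMFDerivAt
  have h2 := (h1.comp x (D.contMDiff_Gvec.mdifferentiable (by simp) x).hasMFDerivAt).mfderiv
  exact (DFunLike.congr_fun h2 v).symm

/-- The matrix `c(x)` has rank `m = |I| - |K|`, so there are `m` linear equations for its kernel. -/
lemma exists_equations (x : M) {m : ℕ} (hm : Fintype.card I = m + Fintype.card K) :
    ∃ Q : (I → ℝ) →L[ℝ] (Fin m → ℝ), Function.Surjective Q ∧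
      ∀ y, Q y = 0 ↔ D.cAt x *ᵥ y = 0 := by
  have hker : LinearMap.ker (D.cAt x).mulVecLin = LinearMap.range (D.SAt x).mulVecLin := by
    ext y
    constructor
    · exact fun hy => D.exists_SAt_mulVec_eq hy
    · rintro ⟨z, rfl⟩
      change D.cAt x *ᵥ (D.SAt x *ᵥ z) = 0
      rw [Matrix.mulVec_mulVec, D.cAt_mul_SAt, Matrix.zero_mulVec]
  have hinj : Function.Injective (D.SAt x).mulVecLin := by
    rw [← LinearMap.ker_eq_bot, LinearMap.ker_eq_bot']
    exact fun z hz => D.injective x z fun i => congrFun hz i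
  have hrank : Module.finrank ℝ (LinearMap.range (D.cAt x).mulVecLin)
      = Module.finrank ℝ (Fin m → ℝ) := by
    have h1 := (D.cAt x).mulVecLin.finrank_range_add_finrank_ker
    rw [hker, LinearMap.finrank_range_of_inj hinj, Module.finrank_pi, Module.finrank_pi] at h1
    rw [Module.finrank_pi, Fintype.card_fin]
    omega
  let q := LinearEquiv.ofFinrankEq _ _ hrank
  refine ⟨LinearMap.toContinuousLinearMap (q.toLinearMap ∘ₗ (D.cAt x).mulVecLin.rangeRestrict),
    ?_, fun y => ?_⟩
  · exact q.surjective.comp (LinearMap.surjective_rangeRestrict _)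
  · change q ((D.cAt x).mulVecLin.rangeRestrict y) = 0 ↔ _
    rw [LinearEquiv.map_eq_zero_iff, ← Subtype.val_inj]
    rfl

variable [DecidableEq I]

/-- At every point, the constraints form a submersion onto the image of `c(x)`: their derivatives
in the directions `X_{H_j}` are the columns of `c(x)²`. -/
lemma surjective_comp_mfderiv_Gvec {x : M} {F : Type*} [NormedAddCommGroup F] [NormedSpace ℝ F]
    {Q : (I → ℝ) →L[ℝ] F} (hQ : Function.Surjective Q)
    (hQ0 : ∀ y, Q y = 0 ↔ D.cAt x *ᵥ y = 0) (z : F) :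
    ∃ v : TangentSpace 𝓘(ℝ, E) x, Q (mfderiv 𝓘(ℝ, E) 𝓘(ℝ, I → ℝ) D.Gvec x v) = z := by
  obtain ⟨y, rfl⟩ := hQ z
  let y' : I → ℝ := (D.T⁻¹ * D.T⁻¹).map (smoothEval x) *ᵥ y
  refine ⟨∑ j, y' j • π.hamVF (D.H j) x, ?_⟩
  have h1 : (mfderiv 𝓘(ℝ, E) 𝓘(ℝ, I → ℝ) D.Gvec x (∑ j, y' j • π.hamVF (D.H j) x) : I → ℝ)
      = (D.c * D.c).map (smoothEval x) *ᵥ y' := by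
    funext i
    rw [mfderiv_Gvec_apply]
    simp only [map_sum, map_smul, smul_eq_mul, ← bracket_apply_hamVF, bracket_G_H]
    exact Finset.sum_congr rfl fun j _ => mul_comm _ _
  have h2 : D.c * D.c * D.c * D.T⁻¹ * D.T⁻¹ = D.c := by
    rw [mul_c_mul_c_mul_inv, c_mul_c_mul_inv]
  have h3 : D.cAt x *ᵥ ((D.c * D.c).map (smoothEval x) *ᵥ y') = D.cAt x *ᵥ y := by
    have h4 := congrArg (fun X => X.map (smoothEval x) *ᵥ y) h2
    simp only [Matrix.map_mul, ← Matrix.mulVec_mulVec] at h4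
    simp only [y', cAt, Matrix.map_mul, ← Matrix.mulVec_mulVec]
    exact h4
  refine (congrArg Q h1).trans ?_
  rw [← sub_eq_zero, ← map_sub, hQ0, Matrix.mulVec_sub, h3, sub_self]

omit [DecidableEq I] in
lemma continuous_SAt : Continuous D.SAt :=
  continuous_matrix fun i l => (D.S i l).contMDiff.continuous

/-- Near `x`, the constraints vanish as soon as their image under `c(x)` does: `G(y)` satisfies
`S(y)ᵀ G(y) = 0`, and `c(x) + S(x) S(y)ᵀ` is invertible for `y` near `x`. -/
lemma eventually_G_eq_zero_iff {x : M} {F : Type*} [NormedAddCommGroup F] [NormedSpace ℝ F]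
    {Q : (I → ℝ) →L[ℝ] F} (hQ0 : ∀ y, Q y = 0 ↔ D.cAt x *ᵥ y = 0) :
    ∀ᶠ y in 𝓝 x, (∀ i, D.G i y = 0) ↔ Q (D.Gvec y) = 0 := by
  have hcont : Continuous fun y => (D.cAt x + D.SAt x * (D.SAt y)ᵀ).det :=
    (continuous_const.add
      (continuous_const.matrix_mul D.continuous_SAt.matrix_transpose)).matrix_det
  have hx : (D.cAt x + D.SAt x * (D.SAt x)ᵀ).det ≠ 0 :=
    det_add_mul_transpose_ne_zero (D.cAt_transpose x) (D.cAt_mul_SAt x)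
      fun y hy => D.exists_SAt_mulVec_eq hy
  filter_upwards [hcont.continuousAt.eventually_ne hx] with y hy
  constructor
  · intro h
    have : D.Gvec y = 0 := funext h
    rw [this, map_zero]
  · intro h
    rw [hQ0] at h
    have h1 : (D.cAt x + D.SAt x * (D.SAt y)ᵀ) *ᵥ D.Gvec y = 0 := by
      rw [Matrix.add_mulVec, h, ← Matrix.mulVec_mulVec, zero_add]
      have := D.SAt_transpose_mulVec_G y
      change D.SAt x *ᵥ ((D.SAt y)ᵀ *ᵥ fun i => D.G i y) = 0
      rw [this, Matrix.mulVec_zero]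
    have h2 : D.Gvec y = 0 := by
      by_contra hne
      exact hy (Matrix.exists_mulVec_eq_zero_iff.1 ⟨_, hne, h1⟩)
    exact fun i => congrFun h2 i

variable [FiniteDimensional ℝ E] [IsManifold 𝓘(ℝ, E) ∞ M] [T2Space M]

/-- The zero set of the constraints is an embedded submanifold, of codimension the rank of `c`, for
which they are second class. -/
theorem exists_secondClass {N : Set M} (hN : ∀ x, x ∈ N ↔ ∀ i, D.G i x = 0) (hne : N.Nonempty)
    (hcard : Fintype.card K ≤ Fintype.card I) :
    ∃ (n : ℕ) (_ : ChartedSpace (EuclideanSpace ℝ (Fin n)) N)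
      (_ : IsManifold 𝓘(ℝ, EuclideanSpace ℝ (Fin n)) ∞ N)
      (S : π.SecondClass I (EuclideanSpace ℝ (Fin n)) ((↑) : N → M)),
      n + Fintype.card I = Module.finrank ℝ E + Fintype.card K ∧
      Manifold.IsSmoothEmbedding 𝓘(ℝ, EuclideanSpace ℝ (Fin n)) 𝓘(ℝ, E) ∞ ((↑) : N → M) ∧
      S.G = D.G := by
  obtain ⟨m, hm⟩ := Nat.exists_eq_add_of_le' hcard
  choose Q hQ hQ0 using fun x : M => D.exists_equations x hm
  have hg : ∀ x, ContMDiff 𝓘(ℝ, E) 𝓘(ℝ, Fin m → ℝ) ∞ (Q x ∘ D.Gvec) := fun x =>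
    (Q x).contDiff.contMDiff.comp D.contMDiff_Gvec
  have hder : ∀ (x : M) (v : TangentSpace 𝓘(ℝ, E) x),
      mfderiv 𝓘(ℝ, E) 𝓘(ℝ, Fin m → ℝ) (Q x ∘ D.Gvec) x v
        = Q x (mfderiv 𝓘(ℝ, E) 𝓘(ℝ, I → ℝ) D.Gvec x v) := fun x v => by
    have h1 : HasMFDerivAt 𝓘(ℝ, I → ℝ) 𝓘(ℝ, Fin m → ℝ) (Q x) (D.Gvec x) (Q x) :=
      (Q x).hasFDerivAt.hasMFDerivAt
    rw [(h1.comp x (D.contMDiff_Gvec.mdifferentiable (by simp) x).hasMFDerivAt).mfderiv]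
    rfl
  have hsurj : ∀ x, Function.Surjective
      (mfderiv 𝓘(ℝ, E) 𝓘(ℝ, Fin m → ℝ) (Q x ∘ D.Gvec) x) := fun x z => by
    obtain ⟨v, hv⟩ := D.surjective_comp_mfderiv_Gvec (hQ x) (hQ0 x) z
    exact ⟨v, (hder x v).trans hv⟩
  obtain ⟨x₀, -⟩ := hne
  have hmE : m ≤ Module.finrank ℝ E := by
    have := LinearMap.finrank_le_finrank_of_surjective
      (f := (show E →L[ℝ] (Fin m → ℝ) from
        mfderiv 𝓘(ℝ, E) 𝓘(ℝ, Fin m → ℝ) (Q x₀ ∘ D.Gvec) x₀).toLinearMap) (hsurj x₀)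
    simpa using this
  obtain ⟨n, hn⟩ := Nat.exists_eq_add_of_le' hmE
  have hdim : Module.finrank ℝ E
      = Module.finrank ℝ (EuclideanSpace ℝ (Fin n)) + Module.finrank ℝ (Fin m → ℝ) := by
    simp [hn]
  have hslice : ∀ x : N, ∃ s : SliceChart E N (EuclideanSpace ℝ (Fin n)) (Fin m → ℝ),
      (x : M) ∈ s.chart.source := fun x => by
    refine exists_sliceChart (hg x) (hsurj x) ?_ hdim
    filter_upwards [D.eventually_G_eq_zero_iff (hQ0 x)] with y hy
    rw [hN, hy]
    rfl
  choose t ht using hslice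
  let _ : ChartedSpace (EuclideanSpace ℝ (Fin n)) N := SliceChart.chartedSpace t ht
  have hman : IsManifold 𝓘(ℝ, EuclideanSpace ℝ (Fin n)) ∞ N := SliceChart.isManifold t ht
  have hemb := SliceChart.isSmoothEmbedding t ht
  have hsm : ContMDiff 𝓘(ℝ, EuclideanSpace ℝ (Fin n)) 𝓘(ℝ, E) ∞ ((↑) : N → M) := hemb.contMDiff
  have hG : ∀ (x : N) (i : I), D.G i x = 0 := fun x => (hN x).1 x.2
  refine ⟨n, inferInstance, hman, ⟨D.G, D.A, fun x k => D.hamVF_G_eq k x, hG, fun x v hv => ?_, hsm,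
    SliceChart.exists_retraction t ht⟩, by omega, hemb, rfl⟩
  obtain ⟨r, hr, hrι⟩ := SliceChart.exists_retraction t ht x
  have hinj : Function.Injective (mfderiv 𝓘(ℝ, EuclideanSpace ℝ (Fin n)) 𝓘(ℝ, E)
      ((↑) : N → M) x) :=
    Function.LeftInverse.injective (mfderiv_retraction_apply hsm hr.self_of_nhds hrι)
  let J : EuclideanSpace ℝ (Fin n) →L[ℝ] E :=
    mfderiv 𝓘(ℝ, EuclideanSpace ℝ (Fin n)) 𝓘(ℝ, E) ((↑) : N → M) x
  let P : E →L[ℝ] (Fin m → ℝ) := mfderiv 𝓘(ℝ, E) 𝓘(ℝ, Fin m → ℝ) (Q x ∘ D.Gvec) (x : M)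
  refine ker_le_range_of_finrank_eq (J := J.toLinearMap) (D := P.toLinearMap)
    hinj (hsurj x) (fun w => ?_) hdim ?_
  · have h1 := ((hg x).mdifferentiable (by simp) (x : M)).hasMFDerivAt.comp x
      (hsm.mdifferentiable (by simp) x).hasMFDerivAt
    have h2 : (Q x ∘ D.Gvec) ∘ ((↑) : N → M) = fun _ => 0 := by
      funext y
      have : D.Gvec y = 0 := funext (hG y)
      simp [this]
    rw [h2] at h1
    exact DFunLike.congr_fun (hasMFDerivAt_unique h1 (hasMFDerivAt_const _ _)) w
  · change mfderiv 𝓘(ℝ, E) 𝓘(ℝ, Fin m → ℝ) (Q x ∘ D.Gvec) (x : M) v = 0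
    rw [hder]
    have : (mfderiv 𝓘(ℝ, E) 𝓘(ℝ, I → ℝ) D.Gvec x v : I → ℝ) = 0 := by
      funext i
      rw [mfderiv_Gvec_apply]
      exact hv i
    exact (congrArg (Q x) this).trans (map_zero _)

end KernelFrame

end PoissonStructure

/-! ### Framings of the kernel of the cocycle -/

lemma exists_orthonormal_basis {V : Type*} [AddCommGroup V] [Module ℝ V] [FiniteDimensional ℝ V]
    {B : LinearMap.BilinForm ℝ V} (hB : B.IsSymm) (hpos : ∀ u, u ≠ 0 → 0 < B u u) :
    ∃ e : Module.Basis (Fin (Module.finrank ℝ V)) ℝ V,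
      ∀ i j, B (e i) (e j) = if i = j then 1 else 0 := by
  obtain ⟨v, hv⟩ := LinearMap.BilinForm.exists_orthogonal_basis (B := B)
    ⟨fun x y => hB.eq x y⟩
  have hp : ∀ i, 0 < B (v i) (v i) := fun i => hpos _ (v.ne_zero i)
  have hs : ∀ i, IsUnit (Real.sqrt (B (v i) (v i)))⁻¹ := fun i =>
    (inv_ne_zero (Real.sqrt_pos.2 (hp i)).ne').isUnit
  refine ⟨v.isUnitSMul hs, fun i j => ?_⟩
  rw [v.isUnitSMul_apply, v.isUnitSMul_apply, map_smul, map_smul, LinearMap.smul_apply]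
  split_ifs with h
  · subst h
    have h1 := Real.mul_self_sqrt (hp i).le
    have h2 := (Real.sqrt_pos.2 (hp i)).ne'
    simp only [smul_eq_mul]
    field_simp
    nlinarith
  · rw [LinearMap.isOrthoᵢ_def.1 hv i j h]
    simp

namespace PoissonStructure

variable {E : Type*} [NormedAddCommGroup E] [NormedSpace ℝ E]
  {M : Type*} [TopologicalSpace M] [ChartedSpace E M] {π : PoissonStructure E M}
  {𝔤 : Type*} [LieRing 𝔤] [LieAlgebra ℝ 𝔤]
  {ρ : 𝔤 →ₗ[ℝ] C^∞⟮𝓘(ℝ, E), M; ℝ⟯}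

lemma cocycle_of_isLieAbelian [IsLieAbelian 𝔤] (u v : 𝔤) :
    π.cocycle ρ u v = π.bracket (ρ u) (ρ v) := by
  rw [cocycle_apply, trivial_lie_zero, map_zero, sub_zero]

lemma bracket_eq_zero_of_mem_kerCocycle [IsLieAbelian 𝔤] {x : M} {u : 𝔤}
    (hu : u ∈ π.kerCocycle ρ x) (v : 𝔤) : π.bracket (ρ u) (ρ v) x = 0 := by
  rw [← cocycle_of_isLieAbelian]
  exact (π.mem_kerCocycle ρ).1 hu v

variable {ι : Type*} [Fintype ι] (e : Module.Basis ι ℝ 𝔤)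

lemma bracket_sum_smul_right (y : ι → ℝ) (f : C^∞⟮𝓘(ℝ, E), M; ℝ⟯) (x : M) :
    π.bracket f (ρ (∑ j, y j • e j)) x = ∑ j, π.bracket f (ρ (e j)) x * y j := by
  simp only [map_sum, map_smul]
  rw [← smoothEval_apply, map_sum]
  exact Finset.sum_congr rfl fun j _ => mul_comm _ _

lemma mem_kerCocycle_iff_coord [IsLieAbelian 𝔤] {x : M} {y : ι → ℝ} :
    ∑ j, y j • e j ∈ π.kerCocycle ρ x ↔
      ∀ i, ∑ j, π.bracket (ρ (e i)) (ρ (e j)) x * y j = 0 := by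
  constructor
  · intro h i
    rw [← bracket_sum_smul_right, bracket_skew_apply, bracket_eq_zero_of_mem_kerCocycle h, neg_zero]
  · intro h
    rw [mem_kerCocycle]
    intro v
    rw [cocycle_of_isLieAbelian, bracket_skew_apply, neg_eq_zero]
    have h1 := fun i => (bracket_sum_smul_right (π := π) (ρ := ρ) e y (ρ (e i)) x).trans (h i)
    rw [← e.sum_repr v]
    rw [bracket_skew_apply, bracket_sum_smul_right, neg_eq_zero]
    refine Finset.sum_eq_zero fun i _ => ?_
    rw [bracket_skew_apply, h1, neg_zero, zero_mul]

namespace LeafFraming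

variable {k : ℕ} (b : π.LeafFraming (π.kerCocycle ρ) k)

/-- The coordinates in the basis `e` of the section of `ker c` with constant value `w` in the
framing. -/
def coord (w : Fin k → ℝ) (i : ι) : C^∞⟮𝓘(ℝ, E), M; ℝ⟯ :=
  ⟨fun x => e.coord i ((b.equiv x).symm w), b.smooth w (e.coord i)⟩

omit [Fintype ι] in
lemma coord_apply (w : Fin k → ℝ) (i : ι) (x : M) :
    b.coord e w i x = e.repr ((b.equiv x).symm w : 𝔤) i := rfl

omit [Fintype ι] in
lemma sum_coord_single (z : Fin k → ℝ) (i : ι) (x : M) :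
    ∑ l, b.coord e (Pi.single l 1) i x * z l = b.coord e z i x := by
  have h : z = ∑ l, z l • (Pi.single l (1 : ℝ) : Fin k → ℝ) := pi_eq_sum_univ' z
  conv_rhs => rw [h]
  simp only [coord_apply, map_sum, map_smul, Submodule.coe_sum, Submodule.coe_smul,
    Finsupp.coe_finsetSum, Finset.sum_apply, Finsupp.smul_apply, smul_eq_mul]
  exact Finset.sum_congr rfl fun l _ => mul_comm _ _

lemma sum_coord_smul (w : Fin k → ℝ) (x : M) :
    ∑ i, b.coord e w i x • e i = ((b.equiv x).symm w : 𝔤) := e.sum_repr _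

/-- The function `x ↦ H_{u(x)}(x)`, where `u(x)` corresponds to `w` in the framing. It restricts
to the residual Hamiltonian. -/
def residual (w : Fin k → ℝ) : C^∞⟮𝓘(ℝ, E), M; ℝ⟯ := ∑ i, b.coord e w i * ρ (e i)

lemma residual_apply (w : Fin k → ℝ) (x : M) :
    b.residual e w x = ρ ((b.equiv x).symm w) x := by
  rw [← b.sum_coord_smul e, map_sum, residual, ← smoothEval_apply, ← smoothEval_apply, map_sum,
    map_sum]
  refine Finset.sum_congr rfl fun i _ => ?_
  rw [map_mul, map_smul]
  rfl

/-- The kernel frame given by a framing of `ker c` for an action of an abelian Lie algebra. -/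
def kernelFrame [IsLieAbelian 𝔤] (hρ : π.IsWeaklyHamiltonian ρ) : π.KernelFrame ι (Fin k) where
  H i := ρ (e i)
  S := Matrix.of fun i l => b.coord e (Pi.single l 1) i
  isCasimir i j := by
    rw [← cocycle_of_isLieAbelian]
    exact hρ _ _
  sum_mul_eq_zero i l := by
    ext x
    rw [← smoothEval_apply, map_sum]
    refine (mem_kerCocycle_iff_coord (π := π) (ρ := ρ) e (x := x)
      (y := fun j => b.coord e (Pi.single l 1) j x)).1 ?_ i
    rw [sum_coord_smul]
    exact Subtype.property _
  exists_eq x y hy := by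
    refine ⟨b.equiv x ⟨_, (mem_kerCocycle_iff_coord e).2 hy⟩, fun i => ?_⟩
    refine (b.sum_coord_single e _ i x).trans ?_
    rw [coord_apply, LinearEquiv.symm_apply_apply]
    exact congrFun ((e.repr_sum_self y)) i
  injective x z hz := by
    have h : ((b.equiv x).symm z : 𝔤) = 0 := by
      rw [← b.sum_coord_smul e]
      refine Finset.sum_eq_zero fun i _ => ?_
      rw [← sum_coord_single]
      exact (congrArg (· • e i) (hz i)).trans (zero_smul _ _)
    simpa using h

lemma card_le (e : Module.Basis ι ℝ 𝔤) (b : π.LeafFraming (π.kerCocycle ρ) k) (x : M) :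
    k ≤ Fintype.card ι := by
  have : Module.Finite ℝ 𝔤 := Module.Finite.of_basis e
  have h1 := (b.equiv x).finrank_eq
  have h2 := Submodule.finrank_le (π.kerCocycle ρ x)
  rw [h1, Module.finrank_eq_card_basis e] at h2
  simpa using h2

variable [FiniteDimensional ℝ E] [IsManifold 𝓘(ℝ, E) ∞ M] [T2Space M]

omit [Fintype ι] in
lemma isCasimir_coord (w : Fin k → ℝ) (i : ι) : π.IsCasimir (b.coord e w i) :=
  isCasimir_of_sameLeaf π fun x y hxy => by
    rw [coord_apply, coord_apply, b.constant x y hxy]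

include e in
lemma symm_integralCurve_eq {f : C^∞⟮𝓘(ℝ, E), M; ℝ⟯} {γ : ℝ → M}
    (hγ : IsMIntegralCurve γ (π.hamVF f)) (w : Fin k → ℝ) (t : ℝ) :
    ((b.equiv (γ t)).symm w : 𝔤) = (b.equiv (γ 0)).symm w := by
  rw [← b.sum_coord_smul e, ← b.sum_coord_smul e]
  exact Finset.sum_congr rfl fun i _ => by rw [(b.isCasimir_coord e w i).apply_integralCurve hγ]

/-- The Hamiltonian vector field of the residual Hamiltonian is that of the fixed element
`u = u(x)`, because `u` varies only transversally to the leaves. -/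
lemma hamVF_residual (w : Fin k → ℝ) (x : M) :
    π.hamVF (b.residual e w) x = π.hamVF (ρ ((b.equiv x).symm w)) x := by
  rw [← b.sum_coord_smul e, map_sum, residual, hamVF_sum, hamVF_sum]
  refine Finset.sum_congr rfl fun i _ => ?_
  rw [hamVF_mul, (b.isCasimir_coord e w i).hamVF_eq_zero, smul_zero, add_zero, map_smul, hamVF_smul]

lemma bracket_residual [IsLieAbelian 𝔤] (v : 𝔤) (w : Fin k → ℝ) (x : M) :
    π.bracket (ρ v) (b.residual e w) x = 0 := by
  rw [bracket_apply_hamVF, hamVF_residual, ← bracket_apply_hamVF, bracket_skew_apply,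
    bracket_eq_zero_of_mem_kerCocycle (Subtype.property _), neg_zero]

end LeafFraming

/-- The image of the skew-symmetric matrix `c(x)` is the orthogonal complement of its kernel, so the
constraints `G = c H` define the same set as the functions `H_u`, `u ∈ (ker c)_x^⊥`. -/
lemma forall_mem_orthogonal_iff [DecidableEq ι] [IsLieAbelian 𝔤] {k : ℕ}
    (b : π.LeafFraming (π.kerCocycle ρ) k)
    (hρ : π.IsWeaklyHamiltonian ρ) {B : LinearMap.BilinForm ℝ 𝔤}
    (he : ∀ i j, B (e i) (e j) = if i = j then 1 else 0) (x : M) :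
    (∀ u ∈ B.orthogonal (π.kerCocycle ρ x), ρ u x = 0) ↔
      ∀ i, (b.kernelFrame e hρ).G i x = 0 := by
  have hB : ∀ y z : ι → ℝ, B (∑ i, y i • e i) (∑ i, z i • e i) = ∑ i, y i * z i := fun y z => by
    simp [he, mul_comm]
  have hρu : ∀ y : ι → ℝ, ρ (∑ i, y i • e i) x = ∑ i, y i * ρ (e i) x := fun y => by
    rw [map_sum, ← smoothEval_apply, map_sum]
    refine Finset.sum_congr rfl fun i _ => ?_
    rw [map_smul]
    rfl
  simp only [KernelFrame.G_apply]
  constructor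
  · intro h i
    have h1 := h (∑ j, π.bracket (ρ (e i)) (ρ (e j)) x • e j) ?_
    · rw [hρu] at h1
      exact h1
    · intro n hn
      rw [← e.sum_repr n] at hn ⊢
      refine (hB _ _).trans ?_
      rw [← mem_kerCocycle_iff_coord e |>.1 hn i]
      exact Finset.sum_congr rfl fun j _ => mul_comm _ _
  · intro h u hu
    have h1 := hu (∑ j, ρ (e j) x • e j) ((mem_kerCocycle_iff_coord e).2 h)
    rw [← e.sum_repr u] at h1
    replace h1 := (hB _ _).symm.trans h1
    rw [← e.sum_repr u, hρu, ← h1]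
    exact Finset.sum_congr rfl fun j _ => mul_comm _ _

end PoissonStructure

/-! ### Flows of the action and the constraints -/

namespace PoissonStructure

variable {E : Type*} [NormedAddCommGroup E] [NormedSpace ℝ E]
  {M : Type*} [TopologicalSpace M] [ChartedSpace E M] {π : PoissonStructure E M}
  {𝔤 : Type*} [LieRing 𝔤] [LieAlgebra ℝ 𝔤] [IsLieAbelian 𝔤]
  {ρ : 𝔤 →ₗ[ℝ] C^∞⟮𝓘(ℝ, E), M; ℝ⟯}
  {ι : Type*} [Fintype ι] (e : Module.Basis ι ℝ 𝔤)
  {k : ℕ} (b : π.LeafFraming (π.kerCocycle ρ) k) (hρ : π.IsWeaklyHamiltonian ρ)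

namespace LeafFraming

lemma bracket_G_apply (i : ι) (u : 𝔤) (x : M) :
    π.bracket ((b.kernelFrame e hρ).G i) (ρ u) x
      = ∑ j, π.bracket (ρ (e i)) (ρ (e j)) x * π.bracket (ρ (e j)) (ρ u) x := by
  rw [KernelFrame.bracket_G_left, ← smoothEval_apply, map_sum]
  simp only [map_mul]
  rfl

lemma isCasimir_bracket_G (i : ι) (u : 𝔤) :
    π.IsCasimir (π.bracket ((b.kernelFrame e hρ).G i) (ρ u)) := by
  rw [KernelFrame.bracket_G_left]
  refine isCasimir_sum fun j _ => ((b.kernelFrame e hρ).isCasimir i j).mul ?_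
  have h := hρ (e j) u
  rw [cocycle_of_isLieAbelian] at h
  exact h

/-- The integral curve of a suitable `X_{H_v}` through any point reaches the zero set of the
constraints at time `1`: along the curve the constraints are affine functions of the time. -/
lemma exists_forall_G_eq_zero [DecidableEq ι] (hcomplete : π.IsCompleteAction ρ) (x : M) :
    ∃ y, ∀ i, (b.kernelFrame e hρ).G i y = 0 := by
  let D := b.kernelFrame e hρ
  -- the velocity `c(x)² v` of `G = c H` has to be `-G(x)`, which holds for `v = -T⁻¹ H(x)`
  let h : ι → ℝ := fun j => ρ (e j) x
  let y : ι → ℝ := -(D.T⁻¹.map (smoothEval x) *ᵥ h)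
  obtain ⟨γ, hγ0, hγ⟩ := hcomplete (∑ j, y j • e j) x
  refine ⟨γ 1, fun i => ?_⟩
  rw [π.apply_integralCurve (b.isCasimir_bracket_G e hρ i _) hγ 1, hγ0, one_mul]
  have h1 : π.bracket (D.G i) (ρ (∑ j, y j • e j)) x = -(D.cAt x *ᵥ h) i := by
    rw [bracket_sum_smul_right]
    have h2 : ∀ j, π.bracket (D.G i) (ρ (e j)) = (D.c * D.c) i j := fun j => D.bracket_G_H i j
    have h3 : ((D.c * D.c).map (smoothEval x) *ᵥ y) = -(D.cAt x *ᵥ h) := by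
      simp only [y, Matrix.mulVec_neg, Matrix.mulVec_mulVec, ← Matrix.map_mul]
      rw [D.c_mul_c_mul_inv]
      rfl
    rw [← Pi.neg_apply, ← h3]
    simp only [h2]
    rfl
  have h4 : D.G i x = (D.cAt x *ᵥ h) i := D.G_apply i x
  change D.G i x + π.bracket (D.G i) (ρ (∑ j, y j • e j)) x = 0
  rw [h1, h4, add_neg_cancel]

/-- The flow of `X_{H_u}`, `u ∈ (ker c)_x`, through `x` preserves the constraints. -/
lemma G_integralCurve_eq {u : 𝔤} {γ : ℝ → M} (hγ : IsMIntegralCurve γ (π.hamVF (ρ u)))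
    (hu : u ∈ π.kerCocycle ρ (γ 0)) (i : ι) (t : ℝ) :
    (b.kernelFrame e hρ).G i (γ t) = (b.kernelFrame e hρ).G i (γ 0) := by
  rw [π.apply_integralCurve (b.isCasimir_bracket_G e hρ i _) hγ t, bracket_G_apply,
    Finset.sum_eq_zero fun j _ => ?_, mul_zero, add_zero]
  rw [π.bracket_skew_apply (ρ (e j)) (ρ u), bracket_eq_zero_of_mem_kerCocycle hu, neg_zero,
    mul_zero]

variable [FiniteDimensional ℝ E] [IsManifold 𝓘(ℝ, E) ∞ M] [T2Space M]

lemma isAdmissible_residual {E' : Type*} [NormedAddCommGroup E'] [NormedSpace ℝ E'] {N : Type*}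
    [TopologicalSpace N] [ChartedSpace E' N] {j : N → M} (S : π.SecondClass ι E' j)
    (hS : S.G = (b.kernelFrame e hρ).G) (w : Fin k → ℝ) : S.IsAdmissible (b.residual e w) := by
  intro x i
  rw [hS, bracket_skew_apply, KernelFrame.bracket_G_left, ← smoothEval_apply, map_sum, neg_eq_zero]
  refine Finset.sum_eq_zero fun l _ => ?_
  rw [map_mul]
  exact (congrArg _ (b.bracket_residual e (e l) w (j x))).trans (mul_zero _)

end LeafFraming

end PoissonStructure

end

theorem mainTheorem4
    {E : Type*} [NormedAddCommGroup E] [NormedSpace ℝ E] [FiniteDimensional ℝ E]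
    {M : Type*} [TopologicalSpace M] [ChartedSpace E M] [IsManifold 𝓘(ℝ, E) ∞ M]
    [T2Space M] [SecondCountableTopology M] [ConnectedSpace M]
    (π : PoissonStructure E M)
    {𝔤 : Type*} [LieRing 𝔤] [LieAlgebra ℝ 𝔤] [IsLieAbelian 𝔤] [FiniteDimensional ℝ 𝔤]
    (ρ : 𝔤 →ₗ[ℝ] C^∞⟮𝓘(ℝ, E), M; ℝ⟯)
    (hρ : π.IsWeaklyHamiltonian ρ) (hcomplete : π.IsCompleteAction ρ)
    (k : ℕ) (b : π.LeafFraming (π.kerCocycle ρ) k)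
    (B : LinearMap.BilinForm ℝ 𝔤) (hBsymm : B.IsSymm) (hBpos : ∀ u : 𝔤, u ≠ 0 → 0 < B u u)
    (N : Set M)
    (hN : N = {x | ∀ u ∈ B.orthogonal (π.kerCocycle ρ x), ρ u x = 0}) :
    N.Nonempty ∧
    ∃ (n : ℕ) (_ : ChartedSpace (EuclideanSpace ℝ (Fin n)) N)
      (_ : IsManifold 𝓘(ℝ, EuclideanSpace ℝ (Fin n)) ∞ N)
      (πN : PoissonStructure (EuclideanSpace ℝ (Fin n)) N),
      n + Module.finrank ℝ 𝔤 = Module.finrank ℝ E + k ∧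
      π.IsPoissonDirac πN ((↑) : N → M) ∧
      ∃ ρN : (Fin k → ℝ) →ₗ[ℝ] C^∞⟮𝓘(ℝ, EuclideanSpace ℝ (Fin n)), N; ℝ⟯,
        (∀ (w : Fin k → ℝ) (x : N), ρN w x = ρ ((b.equiv x).symm w) x) ∧
        (∀ w w' : Fin k → ℝ, πN.bracket (ρN w) (ρN w') = 0) ∧
        πN.IsCompleteAction ρN ∧
        ∀ (w : Fin k → ℝ) (x : N),
          mfderiv 𝓘(ℝ, EuclideanSpace ℝ (Fin n)) 𝓘(ℝ, E) ((↑) : N → M) x (πN.hamVF (ρN w) x)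
            = π.hamVF (ρ ((b.equiv x).symm w)) x := by
  obtain ⟨e, he⟩ := exists_orthonormal_basis hBsymm hBpos
  let D := b.kernelFrame e hρ
  have hmem : ∀ x, x ∈ N ↔ ∀ i, D.G i x = 0 := fun x => by
    rw [hN]
    exact PoissonStructure.forall_mem_orthogonal_iff e b hρ he x
  obtain ⟨x₀⟩ : Nonempty M := inferInstance
  obtain ⟨y₀, hy₀⟩ := b.exists_forall_G_eq_zero e hρ hcomplete x₀
  have hne : N.Nonempty := ⟨y₀, (hmem y₀).2 hy₀⟩
  obtain ⟨n, hcs, hman, S, hdim, hemb, hSG⟩ := D.exists_secondClass hmem hne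
    (by simpa only [Fintype.card_fin] using b.card_le e x₀)
  refine ⟨hne, n, hcs, hman, S.poissonStructure, by simpa using hdim, S.isPoissonDirac hemb, ?_⟩
  have hadm : ∀ w, S.IsAdmissible (b.residual e w) := b.isAdmissible_residual e hρ S hSG
  let ρN : (Fin k → ℝ) →ₗ[ℝ] C^∞⟮𝓘(ℝ, EuclideanSpace ℝ (Fin n)), N; ℝ⟯ :=
    { toFun := fun w => ⟨fun x => b.residual e w x, (b.residual e w).contMDiff.comp hemb.contMDiff⟩
      map_add' := fun w w' => by
        ext x
        change b.residual e (w + w') x = b.residual e w x + b.residual e w' x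
        simp only [b.residual_apply, map_add, Submodule.coe_add]
        rfl
      map_smul' := fun a w => by
        ext x
        change b.residual e (a • w) x = a * b.residual e w x
        simp only [b.residual_apply, map_smul, Submodule.coe_smul]
        rfl }
  have hρN : ∀ w (x : N), b.residual e w x = ρN w x := fun w x => rfl
  have hham : ∀ (w : Fin k → ℝ) (x : N),
      mfderiv 𝓘(ℝ, EuclideanSpace ℝ (Fin n)) 𝓘(ℝ, E) ((↑) : N → M) x
        (S.poissonStructure.hamVF (ρN w) x) = π.hamVF (ρ ((b.equiv x).symm w)) x := fun w x => by
    rw [(hadm w).mfderiv_hamVF (hρN w) x, b.hamVF_residual]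
  refine ⟨ρN, fun w x => b.residual_apply e w x, fun w w' => ?_, fun w x => ?_, hham⟩
  · ext x
    rw [(hadm w').bracket_apply (hρN w) (hρN w'), π.bracket_skew_apply,
      PoissonStructure.bracket_apply_hamVF, b.hamVF_residual,
      ← PoissonStructure.bracket_apply_hamVF, π.bracket_skew_apply, b.bracket_residual]
    simp
  · obtain ⟨γ, hγ0, hγ⟩ := hcomplete ((b.equiv x).symm w) x
    have hγN : ∀ t, γ t ∈ N := fun t => by
      rw [hmem]
      intro i
      rw [b.G_integralCurve_eq e hρ hγ (by rw [hγ0]; exact Subtype.property _) i t, hγ0]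
      exact (hmem x).1 x.2 i
    refine ⟨fun t => ⟨γ t, hγN t⟩, Subtype.ext hγ0,
      S.isMIntegralCurve (V := π.hamVF (ρ ((b.equiv x).symm w))) (fun t => ?_)
        Topology.IsInducing.subtypeVal hγ⟩
    rw [hham]
    change π.hamVF (ρ ((b.equiv (γ t)).symm w)) (γ t) = _
    rw [b.symm_integralCurve_eq e hγ w t, hγ0]
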